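/- Fix integers $k\ge 2$, $\Delta\ge 3$ and a real $0<\varepsilon<\frac{1}{9k^5\Delta^2}$. Let $\lambda_{c,\varepsilon}$ be any real number (for instance the largest one) such that \[ \left(\frac{\lambda+\varepsilon}{1+\lambda-\varepsilon}\right)^{k/2}<\frac{1}{2\sqrt{2}\,\mathrm{e}\,\Delta k^2}\qquad\text{for all real }\lambda\in[0,\lambda_{c,\varepsilon}), \] and let $D_\varepsilon=\{z\in\mathbb{C} : |z-\lambda|\le\varepsilon\text{ for some }\lambda\in[0,\lambda_{c,\varepsilon})\}$. For a finite hypergraph $H=(V,\mathcal{E})$ call $\sigma\in\{0,1\}^V$ an independent set if every hyperedge $e\in\mathcal{E}$ contains a vertex $v$ with $\sigma(v)=0$, let $\mathcal{I}(H)$ be the set of all independent sets, and for $\boldsymbol{\lambda}=(\lambda_v)_{v\in V}\in\mathbb{C}^V$ define the multivariate independence polynomial \[ Z_H(\boldsymbol{\lambda})=\sum_{\sigma\in\mathcal{I}(H)}\ \prod_{v:\,\sigma(v)=1}\lambda_v . \] Then for every finite $k$-uniform hypergraph $H=(V,\mathcal{E})$ in which every vertex lies in at most $\Delta$ hyperedges,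 $Z_H(\boldsymbol{\lambda})\neq 0$ for all $\boldsymbol{\lambda}\in D_\varepsilon^V$. -/

import Mathlib

/-- `H` is `k`-uniform: every hyperedge consists of exactly `k` vertices
(for `k ≥ 1`, `Set.ncard` equal to `k` forces the hyperedge to be finite). -/
def Hypergraph.IsUniform {α : Type*} (H : Hypergraph α) (k : ℕ) : Prop :=
  ∀ e ∈ H.edgeSet, e.ncard = k

/-- The degree of `v`: the number of hyperedges containing `v`
(only used for hypergraphs with finitely many vertices). -/
noncomputable def Hypergraph.degree {α : Type*} (H : Hypergraph α) (v : α) : ℕ :=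
  {e ∈ H.edgeSet | v ∈ e}.ncard

/-- A configuration `σ ∈ {0,1}^V` is an independent set if every hyperedge contains a vertex `v`
with `σ v = 0`. -/
def Hypergraph.IsIndepConfig {α : Type*} (H : Hypergraph α) (σ : H.vertexSet → Fin 2) : Prop :=
  ∀ e ∈ H.edgeSet, ∃ v : H.vertexSet, (v : α) ∈ e ∧ σ v = 0

open Classical in
/-- The multivariate independence polynomial
`Z_H(lam) = ∑_{σ independent} ∏_{v : σ v = 1} lam v`. -/
noncomputable def Hypergraph.indepPoly {α : Type*} (H : Hypergraph α) [Fintype H.vertexSet]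
    (lam : H.vertexSet → ℂ) : ℂ :=
  ∑ σ : H.vertexSet → Fin 2 with H.IsIndepConfig σ, ∏ v : H.vertexSet with σ v = 1, lam v

/-- The condition `((x + ε) / (1 + x - ε)) ^ (k/2) < 1 / (2 √2 e Δ k²)` on a real fugacity `x`. -/
def LeeYangCondition (k Δ : ℕ) (ε x : ℝ) : Prop :=
  ((x + ε) / (1 + x - ε)) ^ ((k : ℝ) / 2) <
    1 / (2 * Real.sqrt 2 * Real.exp 1 * (Δ : ℝ) * (k : ℝ) ^ 2)

/-- The union of the closed complex discs of radius `ε` centred on the real segment `[0, lamc)`. -/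
def leeYangRegion (ε lamc : ℝ) : Set ℂ :=
  {z : ℂ | ∃ x ∈ Set.Ico (0 : ℝ) lamc, ‖z - (x : ℂ)‖ ≤ ε}

/-!
Hyperedges are added one at a time. If `Z` is the partition function for the hyperedges `E'`, adding
`e` changes it to `Z * (1 - P)`, where `P` is the complex Gibbs probability that `e` is fully
occupied, so it suffices to show `‖P‖ < 1` (`IsScan.norm_sum_occupied_lt`).

The complex Gibbs measure is stationary for the systematic-scan heat-bath dynamics, whose update at
`w` flips a coin with the complex weights `lam w / (1 + lam w)` (heads: occupy `w` unless this
completes a hyperedge) and `1 / (1 + lam w)` (tails: empty `w`); see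
`sum_gibbsWeight_glauberState`. Hence `P` is a sum over coin outcomes. A copy of a hyperedge in
space-time is the set of the last update times of its vertices before some time. It can block an
update only if all its other coins show heads, so whether `e` is occupied at the end is determined
by the cluster of `e` in the graph of space-time copies with all coins heads, unless this cluster
reaches back to the initial state (`IsScan.glauberState_congr_cluster`).

Each cluster contains a dominating two-tree `T`: a set of disjoint copies, connected through steps
of distance at most two, whose neighbourhood contains the cluster (`IsScan.exists_twoTree`). The event
that the two-tree is `T` depends only on the coins within distance two of `T` and forces heads on
all coins of `T`. As a coin has total weight at most `1 + 3 * ε` in modulus, and there are at most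
`Δ ^ 2 * k ^ 5` coins near a given copy, this event together with any bounded local function has
weight at most `(2 * κ) ^ #T`, where `κ` bounds the weight of heads on all of a hyperedge. A copy
has at most `(Δ * k ^ 2) ^ 2` others within distance two, so the generating function of connected sets
(`sum_reachedFrom_le`) bounds the sum over `T` by `1 / 2`. Two-trees reaching the initial state are
large, so their contribution tends to zero as the number of steps grows; here the total variation of
the complex Gibbs measure enters only as a constant.
-/

open Finset

/-! ### Summing over connected sets -/

/-- Every element of `B` can be reached from `A` by a path in `A ∪ B` along the relation `b ∈ Nb a`,
stated through cuts: each nonempty `S ⊆ B` is entered from the rest of `A ∪ B`. -/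
def ReachedFrom {β : Type*} [DecidableEq β] (Nb : β → Finset β) (A B : Finset β) : Prop :=
  ∀ S ⊆ B, S.Nonempty → ∃ s ∈ S, ∃ a ∈ A ∪ (B \ S), s ∈ Nb a

open Classical in
/-- The generating function of the sets reached from `A` is at most `Y ^ #A` as soon as
`(1 + x * Y) ^ D ≤ Y`, where `D` bounds the degrees: choose the neighbours of one `a ∈ A` that
belong to the set, drop `a` and continue from those neighbours. -/
theorem sum_reachedFrom_le {β : Type*} [DecidableEq β] (Nb : β → Finset β) (D : ℕ)
    (x Y : ℝ) (hx : 0 ≤ x) (hY : 1 ≤ Y) (hxY : (1 + x * Y) ^ D ≤ Y)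
    (A R : Finset β) (hD : ∀ a ∈ A ∪ R, #(Nb a) ≤ D) :
    ∑ B ∈ R.powerset with ReachedFrom Nb A B, x ^ #B ≤ Y ^ #A := by
  induction hm : #A + #R using Nat.strong_induction_on generalizing A R with
  | _ m ih =>
  subst hm
  rcases A.eq_empty_or_nonempty with rfl | ⟨a, ha⟩
  · have : {B ∈ R.powerset | ReachedFrom Nb ∅ B} ⊆ {∅} := by
      intro B hB
      rw [mem_filter] at hB
      rw [mem_singleton]
      by_contra hne
      obtain ⟨s, hs, b, hb, -⟩ := hB.2 B subset_rfl (nonempty_iff_ne_empty.2 hne)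
      simp at hb
    calc _ ≤ ∑ B ∈ {(∅ : Finset β)}, x ^ #B :=
          sum_le_sum_of_subset_of_nonneg this fun _ _ _ => by positivity
      _ = _ := by simp
  · set N := R ∩ Nb a with hN
    have hY0 : 0 < Y := by linarith
    have hmaps : ∀ B ∈ {B ∈ R.powerset | ReachedFrom Nb A B}, B ∩ N ∈ N.powerset := by
      intro B _
      exact mem_powerset.2 inter_subset_right
    rw [← sum_fiberwise_of_maps_to hmaps]
    have key : ∀ S ∈ N.powerset,
        ∑ B ∈ {B ∈ R.powerset | ReachedFrom Nb A B} with B ∩ N = S, x ^ #B ≤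
          Y ^ (#A - 1) * (x * Y) ^ #S := by
      intro S hS
      rw [mem_powerset] at hS
      have hlt : #(A.erase a ∪ S) + #(R \ N) < #A + #R := by
        have h1 := card_union_le (A.erase a) S
        have h2 := card_le_card hS
        have h3 : #(R \ N) + #N = #R := by
          rw [card_sdiff_add_card_eq_card]
          exact inter_subset_left
        have h4 := card_erase_add_one ha
        omega
      have hsub : (A.erase a ∪ S) ∪ (R \ N) ⊆ A ∪ R :=
        union_subset (union_subset_union (erase_subset _ _) (hS.trans inter_subset_left))
          (sdiff_subset.trans subset_union_right)
      have hih := ih _ hlt (A.erase a ∪ S) (R \ N) (fun b hb => hD b (hsub hb)) rfl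
      calc ∑ B ∈ {B ∈ R.powerset | ReachedFrom Nb A B} with B ∩ N = S, x ^ #B
          ≤ ∑ B ∈ {B ∈ (R \ N).powerset | ReachedFrom Nb (A.erase a ∪ S) B},
              x ^ (#S + #B) := by
            have hinj : Set.InjOn (fun B => B \ N)
                ({B ∈ {B ∈ R.powerset | ReachedFrom Nb A B} | B ∩ N = S} : Finset (Finset β)) := by
              intro B hB B' hB' h
              have h1 := (mem_filter.1 (mem_coe.1 hB)).2
              have h2 := (mem_filter.1 (mem_coe.1 hB')).2
              rw [← sdiff_union_inter B N, ← sdiff_union_inter B' N, h1, h2]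
              exact congrArg (· ∪ S) h
            have hcard : ∀ B ∈ {B ∈ {B ∈ R.powerset | ReachedFrom Nb A B} | B ∩ N = S},
                x ^ #B = x ^ (#S + #(B \ N)) := by
              intro B hB
              rw [← (mem_filter.1 hB).2, add_comm, card_sdiff_add_card_inter]
            rw [sum_congr rfl hcard, ← sum_image (f := fun B => x ^ (#S + #B)) hinj]
            refine sum_le_sum_of_subset_of_nonneg ?_ fun _ _ _ => by positivity
            intro B' hB'
            obtain ⟨B, hB, rfl⟩ := mem_image.1 hB'
            simp only [mem_filter, mem_powerset] at hB ⊢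
            obtain ⟨⟨hBR, hconn⟩, hBS⟩ := hB
            refine ⟨sdiff_subset_sdiff hBR subset_rfl, fun S' hS' hne => ?_⟩
            obtain ⟨s, hs, b, hb, hsb⟩ := hconn S' (hS'.trans sdiff_subset) hne
            have hsBN := mem_sdiff.1 (hS' hs)
            refine ⟨s, hs, b, ?_, hsb⟩
            have hba : b ≠ a := by
              rintro rfl
              exact hsBN.2 (mem_inter.2 ⟨hBR hsBN.1, hsb⟩)
            rcases mem_union.1 hb with hb | hb
            · exact mem_union_left _ (mem_union_left _ (mem_erase.2 ⟨hba, hb⟩))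
            · obtain ⟨hbB, hbS'⟩ := mem_sdiff.1 hb
              by_cases hbN : b ∈ N
              · exact mem_union_left _ (mem_union_right _ (hBS ▸ mem_inter.2 ⟨hbB, hbN⟩))
              · exact mem_union_right _ (mem_sdiff.2 ⟨mem_sdiff.2 ⟨hbB, hbN⟩, hbS'⟩)
        _ = x ^ #S * ∑ B ∈ {B ∈ (R \ N).powerset | ReachedFrom Nb (A.erase a ∪ S) B}, x ^ #B := by
            rw [mul_sum]
            exact sum_congr rfl fun B _ => pow_add _ _ _
        _ ≤ x ^ #S * Y ^ #(A.erase a ∪ S) := by gcongr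
        _ ≤ x ^ #S * Y ^ ((#A - 1) + #S) := by
            gcongr
            · exact (card_union_le _ _).trans (by rw [card_erase_of_mem ha])
        _ = _ := by rw [pow_add, mul_pow]; ring
    calc _ ≤ ∑ S ∈ N.powerset, Y ^ (#A - 1) * (x * Y) ^ #S := sum_le_sum key
      _ = Y ^ (#A - 1) * (1 + x * Y) ^ #N := by
          rw [← mul_sum]
          congr 1
          have := Finset.prod_add (fun _ => x * Y) (fun _ => (1 : ℝ)) N
          simp only [prod_const, one_pow, mul_one] at this
          rw [← this, add_comm]
      _ ≤ Y ^ (#A - 1) * Y := by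
          gcongr
          refine le_trans (pow_le_pow_right₀ ?_ ((card_le_card inter_subset_right).trans
            (hD a (mem_union_left _ ha)))) hxY
          have := mul_nonneg hx hY0.le
          linarith
      _ = Y ^ #A := by
          rw [← pow_succ, Nat.sub_add_cancel (card_pos.2 ⟨a, ha⟩)]

/-! ### Independent complex coin flips -/

/-- The weight of the outcome that, among the times in `Ω`, exactly those in `R` show heads, for
independent coins of which the coin `t` has the complex weights `q t` and `1 - q t`. -/
noncomputable def coinWeight (q : ℕ → ℂ) (Ω R : Finset ℕ) : ℂ :=
  ∏ t ∈ Ω, if t ∈ R then q t else 1 - q t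

theorem coinWeight_congr (q : ℕ → ℂ) {Ω R R' : Finset ℕ} (h : ∀ t ∈ Ω, t ∈ R ↔ t ∈ R') :
    coinWeight q Ω R = coinWeight q Ω R' :=
  prod_congr rfl fun t ht => by simp only [h t ht]

/-- The expansion over one more coin. -/
theorem sum_coinWeight_insert (q : ℕ → ℂ) {Ω : Finset ℕ} {s : ℕ} (hs : s ∉ Ω)
    (h : Finset ℕ → ℂ) :
    ∑ R ∈ (insert s Ω).powerset, coinWeight q (insert s Ω) R * h R =
      ∑ R ∈ Ω.powerset, coinWeight q Ω R * (q s * h (insert s R) + (1 - q s) * h R) := by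
  rw [sum_powerset_insert hs, ← sum_add_distrib]
  refine sum_congr rfl fun R hR => ?_
  have hsR : s ∉ R := fun h' => hs (mem_powerset.1 hR h')
  have h1 : coinWeight q (insert s Ω) R = (1 - q s) * coinWeight q Ω R := by
    rw [coinWeight, prod_insert hs, if_neg hsR, coinWeight]
  have h2 : coinWeight q (insert s Ω) (insert s R) = q s * coinWeight q Ω R := by
    rw [coinWeight, prod_insert hs, if_pos (mem_insert_self _ _)]
    congr 1
    refine coinWeight_congr q fun t ht => ?_
    rw [mem_insert, or_iff_right]
    rintro rfl
    exact hs ht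
  rw [h1, h2]
  ring

/-- Coins on which `h` does not depend can be integrated out. -/
theorem sum_coinWeight_local (q : ℕ → ℂ) (L Ω : Finset ℕ) (hL : L ⊆ Ω) (h : Finset ℕ → ℂ)
    (hloc : ∀ R ⊆ Ω, h R = h (R ∩ L)) :
    ∑ R ∈ Ω.powerset, coinWeight q Ω R * h R = ∑ R ∈ L.powerset, coinWeight q L R * h R := by
  obtain ⟨K, rfl⟩ : ∃ K, Ω = K ∪ L := ⟨Ω, (union_eq_left.2 hL).symm⟩
  clear hL
  induction K using Finset.induction_on with
  | empty => simp
  | insert s K hs ih =>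
    have ih' := ih fun R hR => hloc R (hR.trans (by rw [insert_union]; exact subset_insert _ _))
    rw [insert_union] at hloc ⊢
    by_cases hsL : s ∈ K ∪ L
    · rwa [insert_eq_of_mem hsL]
    · rw [sum_coinWeight_insert q hsL, ← ih']
      refine sum_congr rfl fun R hR => ?_
      rw [mem_powerset] at hR
      have : h (insert s R) = h R := by
        rw [hloc (insert s R) (insert_subset_insert s hR), hloc R (hR.trans (subset_insert _ _)),
          insert_inter_of_notMem fun h' => hsL (mem_union_right _ h')]
      rw [this]
      ring

/-- A bounded function of the coins in `L` that vanishes unless all coins in `S` show heads. -/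
theorem norm_sum_coinWeight_le (q : ℕ → ℂ) (L Ω S : Finset ℕ) (hL : L ⊆ Ω) (hS : S ⊆ L)
    (h : Finset ℕ → ℂ) (hloc : ∀ R ⊆ Ω, h R = h (R ∩ L)) (hS0 : ∀ R ⊆ Ω, ¬ S ⊆ R → h R = 0)
    (h1 : ∀ R, ‖h R‖ ≤ 1) (B : ℝ) (hB : 1 ≤ B) (hqB : ∀ t, ‖q t‖ + ‖1 - q t‖ ≤ B) :
    ‖∑ R ∈ Ω.powerset, coinWeight q Ω R * h R‖ ≤ (∏ t ∈ S, ‖q t‖) * B ^ #L := by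
  rw [sum_coinWeight_local q L Ω hL h hloc]
  have hterm : ∀ R ∈ L.powerset, ‖coinWeight q L R * h R‖ ≤
      (∏ t ∈ R, ‖q t‖) * ∏ t ∈ L \ R, (if t ∈ S then 0 else ‖1 - q t‖) := by
    intro R hR
    rw [mem_powerset] at hR
    by_cases hSR : S ⊆ R
    · rw [norm_mul]
      refine (mul_le_of_le_one_right (norm_nonneg _) (h1 R)).trans (le_of_eq ?_)
      rw [coinWeight, norm_prod, ← prod_sdiff hR, mul_comm]
      congr 1
      · exact prod_congr rfl fun t ht => by rw [if_pos ht]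
      · refine prod_congr rfl fun t ht => ?_
        have htR := (mem_sdiff.1 ht).2
        rw [if_neg htR, if_neg fun h' => htR (hSR h')]
    · rw [hS0 R (hR.trans hL) hSR, mul_zero, norm_zero]
      refine mul_nonneg (prod_nonneg fun _ _ => norm_nonneg _) (prod_nonneg fun t _ => ?_)
      split_ifs <;> positivity
  calc _ ≤ ∑ R ∈ L.powerset, (∏ t ∈ R, ‖q t‖) * ∏ t ∈ L \ R, (if t ∈ S then 0 else ‖1 - q t‖) :=
        (norm_sum_le _ _).trans (sum_le_sum hterm)
    _ = ∏ t ∈ L, (‖q t‖ + if t ∈ S then 0 else ‖1 - q t‖) := (prod_add _ _ _).symm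
    _ = (∏ t ∈ L \ S, (‖q t‖ + if t ∈ S then 0 else ‖1 - q t‖)) * ∏ t ∈ S, ‖q t‖ := by
        rw [← prod_sdiff hS]
        congr 1
        exact prod_congr rfl fun t ht => by rw [if_pos ht, add_zero]
    _ ≤ (∏ t ∈ L \ S, B) * ∏ t ∈ S, ‖q t‖ := by
        refine mul_le_mul_of_nonneg_right (prod_le_prod (fun t ht => ?_) fun t ht => ?_)
          (prod_nonneg fun _ _ => norm_nonneg _)
        · split_ifs <;> positivity
        · rw [if_neg (mem_sdiff.1 ht).2]
          exact hqB t
    _ ≤ (∏ t ∈ S, ‖q t‖) * B ^ #L := by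
        rw [prod_const, mul_comm]
        refine mul_le_mul_of_nonneg_left ?_ (prod_nonneg fun _ _ => norm_nonneg _)
        exact pow_le_pow_right₀ hB (card_le_card sdiff_subset)

/-! ### The Gibbs weights and the complex Glauber dynamics -/

section Dynamics

variable {V : Type*}

/-- `I` contains no member of `E`. -/
def IsIndepSet (E : Finset (Finset V)) (I : Finset V) : Prop :=
  ∀ e ∈ E, ¬ e ⊆ I

open Classical in
/-- The hard-core weight of `I`, which is `0` if `I` is not independent. -/
noncomputable def gibbsWeight (E : Finset (Finset V)) (lam : V → ℂ) (I : Finset V) : ℂ :=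
  if IsIndepSet E I then ∏ w ∈ I, lam w else 0

variable [DecidableEq V]

open Classical in
/-- The heat-bath update at `w` with coin `b`: heads puts `w` into the set unless this completes a
hyperedge, tails removes it. -/
noncomputable def heatBath (E : Finset (Finset V)) (w : V) (b : Prop) (I : Finset V) : Finset V :=
  if b ∧ ∀ e ∈ E, w ∈ e → ¬ e ⊆ insert w I then insert w I else I.erase w

/-- The state at time `t`, started from `I` at time `t + m`. Time runs backwards: the update at time
`s`, with coin `s ∈ R`, turns the state at time `s + 1` into the state at time `s`. -/
noncomputable def glauberState (E : Finset (Finset V)) (v : ℕ → V) (R : Finset ℕ) (I : Finset V) :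
    ℕ → ℕ → Finset V
  | _, 0 => I
  | t, m + 1 => heatBath E (v t) (t ∈ R) (glauberState E v R I (t + 1) m)

theorem glauberState_congr (E : Finset (Finset V)) (v : ℕ → V) {R R' : Finset ℕ} (I : Finset V)
    (m : ℕ) : ∀ t, (∀ s, t ≤ s → s < t + m → (s ∈ R ↔ s ∈ R')) →
      glauberState E v R I t m = glauberState E v R' I t m := by
  induction m with
  | zero => intros; rfl
  | succ m ih =>
    intro t h
    rw [glauberState, glauberState, ih (t + 1) fun s h1 h2 => h s (by omega) (by omega),
      propext (h t le_rfl (by omega))]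

variable [Fintype V]

/-- The partition function. -/
noncomputable def gibbsSum (E : Finset (Finset V)) (lam : V → ℂ) : ℂ :=
  ∑ I, gibbsWeight E lam I

theorem gibbsSum_empty (lam : V → ℂ) : gibbsSum ∅ lam = ∏ w, (1 + lam w) := by
  have := prod_add lam (fun _ => (1 : ℂ)) univ
  simp only [prod_const_one, mul_one, powerset_univ] at this
  simp only [add_comm (1 : ℂ), this, gibbsSum, gibbsWeight]
  exact sum_congr rfl fun I _ => if_pos fun e he => absurd he (notMem_empty e)

open Classical in
theorem gibbsSum_insert (E : Finset (Finset V)) (lam : V → ℂ) (e : Finset V) :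
    gibbsSum (insert e E) lam =
      gibbsSum E lam - ∑ I, gibbsWeight E lam I * if e ⊆ I then 1 else 0 := by
  rw [gibbsSum, gibbsSum, ← sum_sub_distrib]
  refine sum_congr rfl fun I _ => ?_
  have : IsIndepSet (insert e E) I ↔ ¬ e ⊆ I ∧ IsIndepSet E I := by
    simp [IsIndepSet]
  simp only [gibbsWeight, this]
  by_cases h1 : e ⊆ I <;> by_cases h2 : IsIndepSet E I <;> simp [h1, h2]

/-- The Gibbs weights are invariant under the heat-bath update. -/
theorem sum_gibbsWeight_heatBath (E : Finset (Finset V)) (lam : V → ℂ) (w : V)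
    (hw : 1 + lam w ≠ 0) (g : Finset V → ℂ) :
    ∑ I, gibbsWeight E lam I * g I =
      ∑ I, gibbsWeight E lam I * (lam w / (1 + lam w) * g (heatBath E w True I) +
        (1 - lam w / (1 + lam w)) * g (heatBath E w False I)) := by
  have huniv : (univ : Finset (Finset V)) = (insert w (univ.erase w)).powerset := by
    rw [insert_erase (mem_univ w), powerset_univ]
  rw [huniv, sum_powerset_insert (notMem_erase _ _), sum_powerset_insert (notMem_erase _ _),
    ← sum_add_distrib, ← sum_add_distrib]
  refine sum_congr rfl fun I hI => ?_
  have hwI : w ∉ I := fun h => notMem_erase _ _ (mem_powerset.1 hI h)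
  have hF : heatBath E w False I = I := by
    rw [heatBath, if_neg (by simp), erase_eq_of_notMem hwI]
  have hF' : heatBath E w False (insert w I) = I := by
    rw [heatBath, if_neg (by simp), erase_insert hwI]
  have hT' : heatBath E w True (insert w I) = heatBath E w True I := by
    simp only [heatBath, insert_idem, erase_insert_eq_erase]
    congr
  rw [hF, hF', hT']
  by_cases hind : IsIndepSet E I
  · by_cases hok : ∀ e ∈ E, w ∈ e → ¬ e ⊆ insert w I
    · have hind' : IsIndepSet E (insert w I) := by
        intro e he hsub
        by_cases hwe : w ∈ e
        · exact hok e he hwe hsub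
        · exact hind e he ((subset_insert_iff_of_notMem hwe).1 hsub)
      rw [show heatBath E w True I = insert w I from if_pos ⟨trivial, hok⟩]
      simp only [gibbsWeight, if_pos hind, if_pos hind', prod_insert hwI]
      field_simp
      ring
    · have hind' : ¬ IsIndepSet E (insert w I) := fun h => hok fun e he _ => h e he
      rw [show heatBath E w True I = I.erase w from if_neg fun h => hok h.2,
        erase_eq_of_notMem hwI]
      simp only [gibbsWeight, if_pos hind, if_neg hind']
      ring
  · have hind' : ¬ IsIndepSet E (insert w I) :=
      fun h => hind fun e he hsub => h e he (hsub.trans (subset_insert _ _))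
    simp only [gibbsWeight, if_neg hind, if_neg hind']
    ring

/-- Stationarity: running the dynamics from the Gibbs weights reproduces them. -/
theorem sum_gibbsWeight_glauberState (E : Finset (Finset V)) (lam : V → ℂ)
    (hlam : ∀ w, 1 + lam w ≠ 0) (v : ℕ → V) (m : ℕ) : ∀ (t : ℕ) (g : Finset V → ℂ),
    ∑ I, gibbsWeight E lam I * g I =
      ∑ I, gibbsWeight E lam I * ∑ R ∈ (Ico t (t + m)).powerset,
        coinWeight (fun s => lam (v s) / (1 + lam (v s))) (Ico t (t + m)) R *
          g (glauberState E v R I t m) := by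
  induction m with
  | zero =>
    intro t g
    simp [coinWeight, glauberState]
  | succ m ih =>
    intro t g
    have hI : Ico t (t + (m + 1)) = insert t (Ico (t + 1) (t + 1 + m)) := by
      ext s
      simp only [mem_Ico, mem_insert]
      omega
    rw [sum_gibbsWeight_heatBath E lam (v t) (hlam _), ih (t + 1), hI]
    refine sum_congr rfl fun I _ => ?_
    rw [sum_coinWeight_insert _ (by simp)]
    congr 1
    refine sum_congr rfl fun R hR => ?_
    have htR : t ∉ R := fun h => by
      have := mem_powerset.1 hR h
      simp at this
    have h1 : glauberState E v (insert t R) I (t + 1) m = glauberState E v R I (t + 1) m := by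
      refine glauberState_congr E v I m _ fun s hs _ => ?_
      rw [mem_insert, or_iff_right (by omega)]
    simp only [glauberState, h1, mem_insert_self, htR]

end Dynamics

/-! ### Space-time hyperedges -/

section SpaceTime

variable {V : Type*}

/-- The sequence `v` is a systematic scan of period `n`: every vertex occurs in each window of
length `n`, and only once. -/
structure IsScan (v : ℕ → V) (n : ℕ) : Prop where
  hit : ∀ t w, ∃ s, t ≤ s ∧ s < t + n ∧ v s = w
  sep : ∀ s t, s < t → v s = v t → s + n ≤ t

/-- The first time from `t` on at which `w` is scanned. As the dynamics runs backwards in time, this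
is the update that decides the value of `w` at time `t`. -/
noncomputable def nextTime (v : ℕ → V) (t : ℕ) (w : V) : ℕ :=
  sInf {s | t ≤ s ∧ v s = w}

namespace IsScan

variable {v : ℕ → V} {n : ℕ}

theorem nextTime_eq (hv : IsScan v n) {s t : ℕ} {w : V} (h1 : t ≤ s) (h2 : s < t + n)
    (h3 : v s = w) : nextTime v t w = s := by
  refine le_antisymm (Nat.sInf_le ⟨h1, h3⟩) (le_csInf ⟨s, h1, h3⟩ ?_)
  rintro s' ⟨h1', h3'⟩
  by_contra hlt
  have := hv.sep s' s (by omega) (h3'.trans h3.symm)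
  omega

theorem nextTime_spec (hv : IsScan v n) (t : ℕ) (w : V) :
    t ≤ nextTime v t w ∧ nextTime v t w < t + n ∧ v (nextTime v t w) = w := by
  obtain ⟨s, h1, h2, h3⟩ := hv.hit t w
  rw [hv.nextTime_eq h1 h2 h3]
  exact ⟨h1, h2, h3⟩

theorem nextTime_self (hv : IsScan v n) (t : ℕ) : nextTime v t (v t) = t := by
  obtain ⟨s, h1, h2, -⟩ := hv.hit t (v t)
  exact hv.nextTime_eq le_rfl (by omega) rfl

theorem nextTime_succ (hv : IsScan v n) {t : ℕ} {w : V} (h : w ≠ v t) :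
    nextTime v (t + 1) w = nextTime v t w := by
  obtain ⟨h1, h2, h3⟩ := hv.nextTime_spec t w
  refine hv.nextTime_eq (Nat.lt_of_le_of_ne h1 ?_) (by omega) h3
  intro h'
  exact h (by rw [h', h3])

theorem nextTime_injective (hv : IsScan v n) (t : ℕ) : Function.Injective (nextTime v t) := by
  intro w w' h
  rw [← (hv.nextTime_spec t w).2.2, ← (hv.nextTime_spec t w').2.2, h]

end IsScan

/-- Scanning the vertices cyclically in some order. -/
theorem exists_isScan [Fintype V] [Nonempty V] : ∃ v : ℕ → V, IsScan v (Fintype.card V) := by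
  set n := Fintype.card V with hn
  have hn0 : 0 < n := Fintype.card_pos
  let φ : V ≃ Fin n := Fintype.equivFin V
  refine ⟨fun t => φ.symm ⟨t % n, Nat.mod_lt _ hn0⟩, fun t w => ?_, fun s t hst h => ?_⟩
  · have hmod : (t + ((φ w : ℕ) + (n - t % n)) % n) % n = φ w := by
      have h1 := Nat.mod_add_div t n
      have h2 := Nat.mod_lt t hn0
      have h3 : t + ((φ w : ℕ) + (n - t % n)) = φ w + n * (t / n + 1) := by
        rw [mul_add]
        omega
      rw [Nat.add_mod_mod, h3, Nat.add_mul_mod_self_left, Nat.mod_eq_of_lt (φ w).2]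
    refine ⟨t + ((φ w : ℕ) + (n - t % n)) % n, Nat.le_add_right _ _,
      Nat.add_lt_add_left (Nat.mod_lt _ hn0) t, ?_⟩
    rw [Equiv.symm_apply_eq]
    exact Fin.ext hmod
  · have hmod : s % n = t % n := by simpa using h
    have hdvd : n ∣ t - s := (Nat.modEq_iff_dvd' hst.le).1 hmod
    have := Nat.le_of_dvd (by omega) hdvd
    omega

/-- The times deciding the values of the vertices of the hyperedge `a.2` at time `a.1`. -/
noncomputable def timeSupp (v : ℕ → V) (a : ℕ × Finset V) : Finset ℕ :=
  a.2.image (nextTime v a.1)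

variable {v : ℕ → V} {n : ℕ} {a b c : ℕ × Finset V}

theorem nextTime_mem_timeSupp {w : V} (h : w ∈ a.2) : nextTime v a.1 w ∈ timeSupp v a :=
  mem_image_of_mem _ h

theorem IsScan.self_mem_timeSupp (hv : IsScan v n) (h : v a.1 ∈ a.2) : a.1 ∈ timeSupp v a := by
  have := nextTime_mem_timeSupp (v := v) h
  rwa [hv.nextTime_self] at this

theorem IsScan.bounds_of_mem_timeSupp (hv : IsScan v n) {s : ℕ} (h : s ∈ timeSupp v a) :
    a.1 ≤ s ∧ s < a.1 + n ∧ v s ∈ a.2 := by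
  obtain ⟨w, hw, rfl⟩ := mem_image.1 h
  obtain ⟨h1, h2, h3⟩ := hv.nextTime_spec a.1 w
  exact ⟨h1, h2, by rwa [h3]⟩

theorem IsScan.card_timeSupp (hv : IsScan v n) : #(timeSupp v a) = #a.2 :=
  card_image_of_injective _ (hv.nextTime_injective _)

variable [DecidableEq V]

/-- The space-time hyperedges before time `M`: pairs of a time and a hyperedge containing the vertex
updated at that time. The last condition makes the time the minimum of the support, so that each
support is listed once per hyperedge. -/
def spaceTimeEdges (v : ℕ → V) (E : Finset (Finset V)) (M : ℕ) : Finset (ℕ × Finset V) :=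
  {a ∈ range M ×ˢ E | v a.1 ∈ a.2}

/-- The space-time hyperedges meeting `a` (including `a` itself). -/
noncomputable def meeting (v : ℕ → V) (E : Finset (Finset V)) (M : ℕ) (a : ℕ × Finset V) :
    Finset (ℕ × Finset V) :=
  {b ∈ spaceTimeEdges v E M | ¬ Disjoint (timeSupp v a) (timeSupp v b)}

/-- The space-time hyperedges at distance at most two from `a`. -/
noncomputable def meeting₂ (v : ℕ → V) (E : Finset (Finset V)) (M : ℕ) (a : ℕ × Finset V) :
    Finset (ℕ × Finset V) :=
  (meeting v E M a).biUnion (meeting v E M)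

variable {E : Finset (Finset V)} {M k Δ : ℕ}

theorem mem_spaceTimeEdges : a ∈ spaceTimeEdges v E M ↔ a.1 < M ∧ a.2 ∈ E ∧ v a.1 ∈ a.2 := by
  rw [spaceTimeEdges, mem_filter, mem_product, mem_range, and_assoc]

theorem mem_meeting : b ∈ meeting v E M a ↔
    b ∈ spaceTimeEdges v E M ∧ ∃ s, s ∈ timeSupp v a ∧ s ∈ timeSupp v b := by
  rw [meeting, mem_filter, not_disjoint_iff]

theorem IsScan.mem_meeting_self (hv : IsScan v n) (h : a ∈ spaceTimeEdges v E M) :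
    a ∈ meeting v E M a := by
  have := hv.self_mem_timeSupp (mem_spaceTimeEdges.1 h).2.2
  exact mem_meeting.2 ⟨h, _, this, this⟩

/-- A hyperedge `e` has at most `#e` space-time copies through a given time, as such a copy `(t, e)`
is determined by the vertex `v t ∈ e`. -/
theorem IsScan.card_through_le (hv : IsScan v n) (hE : ∀ e ∈ E, #e = k)
    (hΔ : ∀ w, #{e ∈ E | w ∈ e} ≤ Δ) (s : ℕ) :
    #{b ∈ spaceTimeEdges v E M | s ∈ timeSupp v b} ≤ Δ * k := by
  calc #{b ∈ spaceTimeEdges v E M | s ∈ timeSupp v b}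
      ≤ #({e ∈ E | v s ∈ e}.sigma fun e => e) := by
        refine card_le_card_of_injOn (fun b => ⟨b.2, v b.1⟩) ?_ ?_
        · intro b hb
          obtain ⟨hb, hs⟩ := mem_filter.1 (mem_coe.1 hb)
          obtain ⟨-, hbE, hbv⟩ := mem_spaceTimeEdges.1 hb
          rw [mem_coe, mem_sigma, mem_filter]
          exact ⟨⟨hbE, (hv.bounds_of_mem_timeSupp hs).2.2⟩, hbv⟩
        · rintro ⟨t, e⟩ hb ⟨t', e'⟩ hb' h
          obtain ⟨hb, hs⟩ := mem_filter.1 (mem_coe.1 hb)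
          obtain ⟨hb', hs'⟩ := mem_filter.1 (mem_coe.1 hb')
          have h1 := hv.bounds_of_mem_timeSupp hs
          have h2 := hv.bounds_of_mem_timeSupp hs'
          simp only [Sigma.mk.injEq] at h h1 h2
          obtain ⟨rfl, h⟩ := h
          have hvt : v t = v t' := eq_of_heq h
          rcases lt_trichotomy t t' with hlt | rfl | hlt
          · have := hv.sep t t' hlt hvt
            omega
          · rfl
          · have := hv.sep t' t hlt hvt.symm
            omega
    _ = ∑ e ∈ E with v s ∈ e, #e := card_sigma _ _
    _ = #{e ∈ E | v s ∈ e} * k := by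
        rw [sum_congr rfl fun e he => hE e (mem_filter.1 he).1, sum_const, smul_eq_mul]
    _ ≤ Δ * k := Nat.mul_le_mul_right _ (hΔ _)

theorem IsScan.card_meeting_le (hv : IsScan v n) (hE : ∀ e ∈ E, #e = k)
    (hΔ : ∀ w, #{e ∈ E | w ∈ e} ≤ Δ) (ha : #a.2 ≤ k) : #(meeting v E M a) ≤ Δ * k ^ 2 := by
  have hsub : meeting v E M a ⊆
      (timeSupp v a).biUnion fun s => {b ∈ spaceTimeEdges v E M | s ∈ timeSupp v b} := by
    intro b hb
    obtain ⟨hb, s, h1, h2⟩ := mem_meeting.1 hb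
    exact mem_biUnion.2 ⟨s, h1, mem_filter.2 ⟨hb, h2⟩⟩
  calc _ ≤ #(timeSupp v a) * (Δ * k) := (card_le_card hsub).trans
        (card_biUnion_le_card_mul _ _ _ fun s _ => hv.card_through_le hE hΔ s)
    _ ≤ k * (Δ * k) := Nat.mul_le_mul_right _ (by rwa [hv.card_timeSupp])
    _ = _ := by ring

theorem IsScan.card_meeting₂_le (hv : IsScan v n) (hE : ∀ e ∈ E, #e = k)
    (hΔ : ∀ w, #{e ∈ E | w ∈ e} ≤ Δ) (ha : #a.2 ≤ k) :
    #(meeting₂ v E M a) ≤ (Δ * k ^ 2) ^ 2 := by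
  rw [sq (Δ * k ^ 2)]
  refine (card_biUnion_le_card_mul _ _ (Δ * k ^ 2) fun b hb => ?_).trans
    (Nat.mul_le_mul_right _ (hv.card_meeting_le hE hΔ ha))
  exact hv.card_meeting_le hE hΔ (hE _ (mem_spaceTimeEdges.1 (mem_meeting.1 hb).1).2.1).le

theorem meeting₂_subset : meeting₂ v E M a ⊆ spaceTimeEdges v E M :=
  biUnion_subset.2 fun _ _ => filter_subset _ _

theorem mem_meeting₂ (h1 : b ∈ meeting v E M a) (h2 : c ∈ meeting v E M b) :
    c ∈ meeting₂ v E M a :=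
  mem_biUnion.2 ⟨b, h1, h2⟩

/-! ### Clusters of space-time hyperedges and two-trees inside them -/

open Classical in
/-- The cluster of `ρ`: the space-time hyperedges connected to `ρ` through space-time hyperedges on
which all coins show heads. -/
noncomputable def cluster (v : ℕ → V) (E : Finset (Finset V)) (M : ℕ) (ρ : ℕ × Finset V)
    (R : Finset ℕ) : Finset (ℕ × Finset V) :=
  {b ∈ spaceTimeEdges v E M |
    Relation.ReflTransGen (fun a c => c ∈ meeting v E M a ∧ timeSupp v c ⊆ R) ρ b}

/-- A two-tree rooted at `ρ`: pairwise disjoint space-time hyperedges that are connected to `ρ`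
through steps of distance at most two. -/
structure IsTwoTree (v : ℕ → V) (E : Finset (Finset V)) (M : ℕ) (ρ : ℕ × Finset V)
    (T : Finset (ℕ × Finset V)) : Prop where
  root_mem : ρ ∈ T
  disj : (T : Set (ℕ × Finset V)).PairwiseDisjoint (timeSupp v)
  conn : ReachedFrom (meeting₂ v E M) {ρ} (T.erase ρ)

variable {ρ : ℕ × Finset V} {R R' : Finset ℕ} {C T : Finset (ℕ × Finset V)}

theorem cluster_subset : cluster v E M ρ R ⊆ spaceTimeEdges v E M := by
  classical exact filter_subset _ _

theorem root_mem_cluster (hρ : ρ ∈ spaceTimeEdges v E M) : ρ ∈ cluster v E M ρ R := by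
  classical exact mem_filter.2 ⟨hρ, .refl⟩

theorem mem_cluster_of_meeting (ha : a ∈ cluster v E M ρ R) (hb : b ∈ meeting v E M a)
    (hR : timeSupp v b ⊆ R) : b ∈ cluster v E M ρ R := by
  classical
  exact mem_filter.2 ⟨(mem_meeting.1 hb).1, (mem_filter.1 ha).2.tail ⟨hb, hR⟩⟩

theorem timeSupp_subset_of_mem_cluster (hρR : timeSupp v ρ ⊆ R) (ha : a ∈ cluster v E M ρ R) :
    timeSupp v a ⊆ R := by
  classical
  rcases Relation.ReflTransGen.cases_tail (mem_filter.1 ha).2 with rfl | ⟨b, -, h⟩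
  · exact hρR
  · exact h.2

/-- A set containing the root and closed under passing to meeting members contains the cluster. -/
theorem cluster_subset_of_closed (hρ : ρ ∈ C)
    (hC : ∀ a ∈ C, a ∈ cluster v E M ρ R → ∀ b ∈ meeting v E M a, timeSupp v b ⊆ R → b ∈ C)
    (hρU : ρ ∈ spaceTimeEdges v E M) : cluster v E M ρ R ⊆ C := by
  classical
  intro b hb
  have h := (mem_filter.1 hb).2
  suffices b ∈ C ∧ b ∈ cluster v E M ρ R from this.1
  clear hb
  induction h with
  | refl => exact ⟨hρ, root_mem_cluster hρU⟩
  | tail _ h ih =>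
    exact ⟨hC _ ih.1 ih.2 _ h.1 h.2, mem_cluster_of_meeting ih.2 h.1 h.2⟩

/-- A two-tree in the cluster of maximal size dominates it. -/
theorem IsScan.exists_twoTree (hv : IsScan v n) (hρ : ρ ∈ spaceTimeEdges v E M) :
    ∃ T, IsTwoTree v E M ρ T ∧ T ⊆ cluster v E M ρ R ∧
      cluster v E M ρ R ⊆ T.biUnion (meeting v E M) := by
  classical
  set C := cluster v E M ρ R with hC
  have hne : {T ∈ C.powerset | IsTwoTree v E M ρ T}.Nonempty := by
    refine ⟨{ρ}, mem_filter.2 ⟨?_, ?_, ?_, ?_⟩⟩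
    · rw [mem_powerset, singleton_subset_iff]
      exact root_mem_cluster hρ
    · exact mem_singleton_self _
    · rw [coe_singleton]
      exact Set.pairwiseDisjoint_singleton _ _
    · intro S hS hSne
      rw [erase_singleton, subset_empty] at hS
      exact absurd hS hSne.ne_empty
  obtain ⟨T, hT, hmax⟩ := exists_max_image _ card hne
  obtain ⟨hTC, hT⟩ := mem_filter.1 hT
  rw [mem_powerset] at hTC
  refine ⟨T, hT, hTC, ?_⟩
  refine cluster_subset_of_closed
    (mem_biUnion.2 ⟨ρ, hT.root_mem, hv.mem_meeting_self hρ⟩) (fun a ha haC b hb hbR => ?_) hρ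
  obtain ⟨t, htT, hta⟩ := mem_biUnion.1 ha
  by_contra hbT
  have hbd : ∀ u ∈ T, Disjoint (timeSupp v u) (timeSupp v b) := by
    intro u hu
    by_contra hd
    exact hbT (mem_biUnion.2 ⟨u, hu, mem_filter.2 ⟨(mem_meeting.1 hb).1, hd⟩⟩)
  have hb_notMem : b ∉ T := fun h =>
    hbT (mem_biUnion.2 ⟨b, h, hv.mem_meeting_self (mem_meeting.1 hb).1⟩)
  have hbC : b ∈ C := mem_cluster_of_meeting haC hb hbR
  -- A cluster member `b` that `T` misses but that meets a neighbour `a` of `t ∈ T` extends `T`.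
  have hbig : IsTwoTree v E M ρ (insert b T) := by
    refine ⟨mem_insert_of_mem hT.root_mem, ?_, ?_⟩
    · rw [coe_insert]
      exact hT.disj.insert fun u hu _ => (hbd u hu).symm
    · intro S hS hSne
      by_cases hSb : (S.erase b).Nonempty
      · obtain ⟨s, hs, u, hu, hsu⟩ := hT.conn (S.erase b) (fun s hs => by
          have h1 := mem_erase.1 (hS (mem_of_mem_erase hs))
          exact mem_erase.2 ⟨h1.1, mem_of_mem_insert_of_ne h1.2 (ne_of_mem_erase hs)⟩) hSb
        refine ⟨s, mem_of_mem_erase hs, u, ?_, hsu⟩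
        rcases mem_union.1 hu with hu | hu
        · exact mem_union_left _ hu
        · obtain ⟨hu1, hu2⟩ := mem_sdiff.1 hu
          have huT := mem_of_mem_erase hu1
          have hub : u ≠ b := fun h => hb_notMem (h ▸ huT)
          refine mem_union_right _ (mem_sdiff.2 ⟨mem_erase.2 ⟨ne_of_mem_erase hu1,
            mem_insert_of_mem huT⟩, fun h => hu2 (mem_erase.2 ⟨hub, h⟩)⟩)
      · have hSb' : S = {b} := by
          obtain ⟨s, hs⟩ := hSne
          have hall : ∀ x ∈ S, x = b := fun x hx => by
            by_contra h
            exact hSb ⟨x, mem_erase.2 ⟨h, hx⟩⟩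
          exact eq_singleton_iff_unique_mem.2 ⟨hall s hs ▸ hs, hall⟩
        refine ⟨b, by simp [hSb'], t, ?_, mem_meeting₂ hta hb⟩
        by_cases htρ : t = ρ
        · exact mem_union_left _ (mem_singleton.2 htρ)
        · refine mem_union_right _ (mem_sdiff.2 ⟨mem_erase.2 ⟨htρ, mem_insert_of_mem htT⟩, ?_⟩)
          rw [hSb', mem_singleton]
          rintro rfl
          exact hb_notMem htT
  have hcard := hmax (insert b T) (mem_filter.2 ⟨mem_powerset.2 (insert_subset hbC hTC), hbig⟩)
  rw [card_insert_of_notMem hb_notMem] at hcard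
  omega

open Classical in
/-- A choice of a dominating two-tree, depending on the cluster only. -/
noncomputable def clusterTree (v : ℕ → V) (E : Finset (Finset V)) (M : ℕ) (ρ : ℕ × Finset V)
    (C : Finset (ℕ × Finset V)) : Finset (ℕ × Finset V) :=
  if h : ∃ T, IsTwoTree v E M ρ T ∧ T ⊆ C ∧ C ⊆ T.biUnion (meeting v E M) then h.choose else ∅

theorem IsScan.clusterTree_spec (hv : IsScan v n) (hρ : ρ ∈ spaceTimeEdges v E M) :
    IsTwoTree v E M ρ (clusterTree v E M ρ (cluster v E M ρ R)) ∧
      clusterTree v E M ρ (cluster v E M ρ R) ⊆ cluster v E M ρ R ∧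
      cluster v E M ρ R ⊆
        (clusterTree v E M ρ (cluster v E M ρ R)).biUnion (meeting v E M) := by
  have h := hv.exists_twoTree (R := R) hρ
  rw [clusterTree, dif_pos h]
  exact h.choose_spec

/-- The times on which a cluster dominated by `T` can depend. -/
noncomputable def treeScope (v : ℕ → V) (E : Finset (Finset V)) (M : ℕ)
    (T : Finset (ℕ × Finset V)) : Finset ℕ :=
  (T.biUnion (meeting₂ v E M)).biUnion (timeSupp v)

theorem timeSupp_subset_treeScope (hCT : C ⊆ T.biUnion (meeting v E M)) (ha : a ∈ C)
    (hb : b ∈ meeting v E M a) : timeSupp v b ⊆ treeScope v E M T := by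
  obtain ⟨t, ht, hta⟩ := mem_biUnion.1 (hCT ha)
  exact subset_biUnion_of_mem (timeSupp v) (mem_biUnion.2 ⟨t, ht, mem_meeting₂ hta hb⟩)

/-- The cluster is determined by the coins in the scope of a dominating two-tree. -/
theorem cluster_congr (hρ : ρ ∈ spaceTimeEdges v E M)
    (hCT : cluster v E M ρ R ⊆ T.biUnion (meeting v E M))
    (hRR : ∀ s ∈ treeScope v E M T, s ∈ R ↔ s ∈ R') :
    cluster v E M ρ R' = cluster v E M ρ R := by
  refine Subset.antisymm ?_ ?_
  · refine cluster_subset_of_closed (root_mem_cluster hρ) (fun a ha _ b hb hbR => ?_) hρ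
    refine mem_cluster_of_meeting ha hb fun s hs => ?_
    exact (hRR s (timeSupp_subset_treeScope hCT ha hb hs)).2 (hbR hs)
  · refine cluster_subset_of_closed (root_mem_cluster hρ) (fun a ha haR b hb hbR => ?_) hρ
    refine mem_cluster_of_meeting ha hb fun s hs => ?_
    exact (hRR s (timeSupp_subset_treeScope hCT haR hb hs)).1 (hbR hs)

theorem IsScan.card_treeScope_le (hv : IsScan v n) (hE : ∀ e ∈ E, #e = k)
    (hΔ : ∀ w, #{e ∈ E | w ∈ e} ≤ Δ) (hT : T ⊆ spaceTimeEdges v E M) :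
    #(treeScope v E M T) ≤ #T * ((Δ * k ^ 2) ^ 2 * k) := by
  calc _ ≤ #(T.biUnion (meeting₂ v E M)) * k := by
        refine card_biUnion_le_card_mul _ _ _ fun b hb => ?_
        obtain ⟨t, -, hb⟩ := mem_biUnion.1 hb
        rw [hv.card_timeSupp, hE _ (mem_spaceTimeEdges.1 (meeting₂_subset hb)).2.1]
    _ ≤ (#T * (Δ * k ^ 2) ^ 2) * k := by
        refine Nat.mul_le_mul_right _ (card_biUnion_le_card_mul _ _ _ fun t ht => ?_)
        exact hv.card_meeting₂_le hE hΔ (hE _ (mem_spaceTimeEdges.1 (hT ht)).2.1).le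
    _ = _ := by ring

theorem IsScan.lt_of_mem_meeting₂ (hv : IsScan v n) (h : b ∈ meeting₂ v E M a) :
    b.1 < a.1 + 2 * n := by
  obtain ⟨c, hc, hb⟩ := mem_biUnion.1 h
  obtain ⟨-, s, h1, h2⟩ := mem_meeting.1 hc
  obtain ⟨-, s', h1', h2'⟩ := mem_meeting.1 hb
  have := hv.bounds_of_mem_timeSupp h1
  have := hv.bounds_of_mem_timeSupp h2
  have := hv.bounds_of_mem_timeSupp h1'
  have := hv.bounds_of_mem_timeSupp h2'
  omega

/-- A two-tree whose scope reaches far into the past is large: it has a member in each of the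
intermediate windows of length `2 * n`. -/
theorem IsScan.le_card_of_mem_treeScope (hv : IsScan v n) (hT : IsTwoTree v E M ρ T)
    (hρ : ρ.1 < n) {s J : ℕ} (hs : s ∈ treeScope v E M T) (hJ : 2 * n * J + 3 * n ≤ s) :
    J ≤ #T := by
  obtain ⟨c, hc, hsc⟩ := mem_biUnion.1 hs
  obtain ⟨b, hb, hbc⟩ := mem_biUnion.1 hc
  have hbJ : 2 * n * J ≤ b.1 := by
    have := hv.bounds_of_mem_timeSupp hsc
    have := hv.lt_of_mem_meeting₂ hbc
    omega
  have hsub : Icc 1 J ⊆ T.image fun a => a.1 / (2 * n) := by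
    intro j hj
    obtain ⟨hj1, hj2⟩ := mem_Icc.1 hj
    have hjJ : 2 * n * j ≤ 2 * n * J := Nat.mul_le_mul_left _ hj2
    have hj1' : 2 * n * 1 ≤ 2 * n * j := Nat.mul_le_mul_left _ hj1
    have hbρ : b ≠ ρ := by
      rintro rfl
      omega
    obtain ⟨u, hu, w, hw, huw⟩ := hT.conn {u ∈ T.erase ρ | 2 * n * j ≤ u.1} (filter_subset _ _)
      ⟨b, mem_filter.2 ⟨mem_erase.2 ⟨hbρ, hb⟩, by omega⟩⟩
    obtain ⟨huT, hu⟩ := mem_filter.1 hu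
    have hwlt : w.1 < 2 * n * j := by
      rcases mem_union.1 hw with hw | hw
      · rw [mem_singleton.1 hw]
        omega
      · obtain ⟨hw1, hw2⟩ := mem_sdiff.1 hw
        by_contra hle
        exact hw2 (mem_filter.2 ⟨hw1, by omega⟩)
    have hlt := hv.lt_of_mem_meeting₂ huw
    refine mem_image.2 ⟨u, mem_of_mem_erase huT, ?_⟩
    refine (Nat.div_eq_iff (by omega)).2 ⟨?_, ?_⟩
    · rw [mul_comm]; exact hu
    · rw [mul_comm j]; omega
  have := (card_le_card hsub).trans card_image_le
  rwa [Nat.card_Icc, Nat.add_sub_cancel] at this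

end SpaceTime

/-! ### The dynamics is determined by the cluster -/

section Locality

variable {V : Type*} [DecidableEq V] {E E' : Finset (Finset V)} {v : ℕ → V}
  {n M : ℕ} {ρ : ℕ × Finset V} {R R' : Finset ℕ} {I I' : Finset V} {T : Finset (ℕ × Finset V)}

theorem mem_heatBath_of_ne {w u : V} {b : Prop} (h : u ≠ w) : u ∈ heatBath E w b I ↔ u ∈ I := by
  rw [heatBath]
  split_ifs
  · rw [mem_insert, or_iff_right h]
  · rw [mem_erase, and_iff_right h]

theorem mem_heatBath_self {w : V} {b : Prop} :
    w ∈ heatBath E w b I ↔ b ∧ ∀ e ∈ E, w ∈ e → ¬ e ⊆ insert w I := by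
  rw [heatBath]
  split_ifs with h
  · simpa using h
  · simpa using h

/-- A vertex whose last update showed tails is not in the set. -/
theorem IsScan.nextTime_mem (hv : IsScan v n) (m : ℕ) : ∀ (t : ℕ) (w : V),
    nextTime v t w < t + m → w ∈ glauberState E v R I t m → nextTime v t w ∈ R := by
  induction m with
  | zero =>
    intro t w h
    have := (hv.nextTime_spec t w).1
    omega
  | succ m ih =>
    intro t w h hw
    rw [glauberState] at hw
    by_cases hwt : w = v t
    · subst hwt
      rw [hv.nextTime_self]
      exact (mem_heatBath_self.1 hw).1
    · rw [mem_heatBath_of_ne hwt] at hw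
      rw [← hv.nextTime_succ hwt] at h ⊢
      exact ih (t + 1) w (by omega) hw

/-- Two runs whose coins agree on the scope of a two-tree dominating the cluster agree at all
vertices whose value is decided inside the cluster, provided that they do so at time `M`. -/
theorem IsScan.glauberState_congr_cluster (hv : IsScan v n) (hE' : E' ⊆ E)
    (hρ : ρ ∈ spaceTimeEdges v E M) (hρR : timeSupp v ρ ⊆ R)
    (hCT : cluster v E M ρ R ⊆ T.biUnion (meeting v E M))
    (hRR : ∀ s ∈ treeScope v E M T, s ∈ R ↔ s ∈ R')
    (hbase : ∀ w, nextTime v M w ∈ (cluster v E M ρ R).biUnion (timeSupp v) →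
      (w ∈ glauberState E' v R I M n ↔ w ∈ glauberState E' v R' I' M n)) (j : ℕ) :
    ∀ t, t + j = M → ∀ w, nextTime v t w ∈ (cluster v E M ρ R).biUnion (timeSupp v) →
      (w ∈ glauberState E' v R I t (n + j) ↔ w ∈ glauberState E' v R' I' t (n + j)) := by
  induction j with
  | zero =>
    intro t ht
    obtain rfl : t = M := ht
    exact hbase
  | succ j ih =>
    intro t ht w hw
    have ih' := ih (t + 1) (by omega)
    rw [← add_assoc, glauberState, glauberState]
    by_cases hwt : w = v t
    · subst hwt
      rw [hv.nextTime_self] at hw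
      obtain ⟨a, haC, hta⟩ := mem_biUnion.1 hw
      have htR : t ∈ R := timeSupp_subset_of_mem_cluster hρR haC hta
      have haU := cluster_subset haC
      have htR' : t ∈ R' := (hRR t (timeSupp_subset_treeScope hCT haC
        (hv.mem_meeting_self haU) hta)).1 htR
      rw [mem_heatBath_self, mem_heatBath_self, and_iff_right htR, and_iff_right htR']
      refine forall₃_congr fun e he hte => not_congr ?_
      have hc : (t, e) ∈ spaceTimeEdges v E M :=
        mem_spaceTimeEdges.2 ⟨show t < M by omega, hE' he, hte⟩
      have hmeet : (t, e) ∈ meeting v E M a :=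
        mem_meeting.2 ⟨hc, t, hta, hv.self_mem_timeSupp (a := (t, e)) hte⟩
      -- Either the copy of `e` at time `t` belongs to the cluster, and the induction hypothesis
      -- applies to all its vertices, or one of its coins shows tails in both runs.
      by_cases hcR : timeSupp v (t, e) ⊆ R
      · have hcC := mem_cluster_of_meeting haC hmeet hcR
        have hiff : ∀ u ∈ e, u ∈ insert (v t) (glauberState E' v R I (t + 1) (n + j)) ↔
            u ∈ insert (v t) (glauberState E' v R' I' (t + 1) (n + j)) := by
          intro u hu
          rw [mem_insert, mem_insert]
          by_cases hut : u = v t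
          · simp [hut]
          · refine or_congr_right (ih' u ?_)
            rw [hv.nextTime_succ hut]
            exact mem_biUnion.2 ⟨_, hcC, nextTime_mem_timeSupp (a := (t, e)) hu⟩
        exact ⟨fun h u hu => (hiff u hu).1 (h hu), fun h u hu => (hiff u hu).2 (h hu)⟩
      · obtain ⟨s, hs, hsR⟩ := not_subset.1 hcR
        have hsR' : s ∉ R' := fun h =>
          hsR ((hRR s (timeSupp_subset_treeScope hCT haC hmeet hs)).2 h)
        obtain ⟨u, hu, rfl⟩ := mem_image.1 hs
        have hut : u ≠ v t := by
          rintro rfl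
          exact hsR (by rwa [hv.nextTime_self])
        have hlt := (hv.nextTime_spec t u).2.1
        simp only at hsR hsR' hu
        rw [← hv.nextTime_succ hut] at hsR hsR' hlt
        refine iff_of_false (fun h => ?_) fun h => ?_
        · exact hsR (hv.nextTime_mem _ _ _ (by omega) (mem_of_mem_insert_of_ne (h hu) hut))
        · exact hsR' (hv.nextTime_mem _ _ _ (by omega) (mem_of_mem_insert_of_ne (h hu) hut))
    · rw [mem_heatBath_of_ne hwt, mem_heatBath_of_ne hwt]
      exact ih' w (by rwa [hv.nextTime_succ hwt])

open Classical in
/-- The indicator that the hyperedge `ρ.2` is fully occupied at time `0` and that the cluster of `ρ`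
has the two-tree `T`. -/
noncomputable def treeIndicator (E E' : Finset (Finset V)) (v : ℕ → V) (n M : ℕ)
    (ρ : ℕ × Finset V) (T : Finset (ℕ × Finset V)) (I : Finset V) (R : Finset ℕ) : ℂ :=
  if timeSupp v ρ ⊆ R ∧ clusterTree v E M ρ (cluster v E M ρ R) = T ∧
    ρ.2 ⊆ glauberState E' v R I 0 (n + M) then 1 else 0

theorem norm_treeIndicator_le : ‖treeIndicator E E' v n M ρ T I R‖ ≤ 1 := by
  rw [treeIndicator]
  split_ifs <;> simp

theorem IsScan.treeIndicator_eq_zero (hv : IsScan v n) (hρ : ρ ∈ spaceTimeEdges v E M)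
    (h : ¬ T.biUnion (timeSupp v) ⊆ R) : treeIndicator E E' v n M ρ T I R = 0 := by
  rw [treeIndicator, if_neg]
  rintro ⟨h1, rfl, -⟩
  refine h (biUnion_subset.2 fun a ha => ?_)
  exact timeSupp_subset_of_mem_cluster h1 ((hv.clusterTree_spec hρ).2.1 ha)

/-- If the tree does not reach beyond time `M`, the indicator does not depend on the initial state
and on the coins outside the scope of the tree; otherwise the initial state and the coins beyond
time `M` have to be fixed too. -/
theorem IsScan.treeIndicator_congr (hv : IsScan v n) (hE' : E' ⊆ E)
    (hρ : ρ ∈ spaceTimeEdges v E M) (hρ0 : ∀ w ∈ ρ.2, nextTime v 0 w = nextTime v ρ.1 w)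
    (hRR : ∀ s ∈ treeScope v E M T, s ∈ R ↔ s ∈ R')
    (hbase : (∀ s ∈ treeScope v E M T, s < M) ∨
      (I = I' ∧ ∀ s, M ≤ s → s < M + n → (s ∈ R ↔ s ∈ R'))) :
    treeIndicator E E' v n M ρ T I R = treeIndicator E E' v n M ρ T I' R' := by
  classical
  suffices H : ∀ (R R' : Finset ℕ) (I I' : Finset V),
      (∀ s ∈ treeScope v E M T, s ∈ R ↔ s ∈ R') →
      ((∀ s ∈ treeScope v E M T, s < M) ∨
        (I = I' ∧ ∀ s, M ≤ s → s < M + n → (s ∈ R ↔ s ∈ R'))) →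
      (timeSupp v ρ ⊆ R ∧ clusterTree v E M ρ (cluster v E M ρ R) = T ∧
        ρ.2 ⊆ glauberState E' v R I 0 (n + M)) →
      (timeSupp v ρ ⊆ R' ∧ clusterTree v E M ρ (cluster v E M ρ R') = T ∧
        ρ.2 ⊆ glauberState E' v R' I' 0 (n + M)) by
    rw [treeIndicator, treeIndicator]
    congr 1
    refine propext ⟨H R R' I I' hRR hbase, H R' R I' I (fun s hs => (hRR s hs).symm) ?_⟩
    exact hbase.imp_right fun h => ⟨h.1.symm, fun s h1 h2 => (h.2 s h1 h2).symm⟩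
  rintro R R' I I' hRR hbase ⟨hρR, hT, hocc⟩
  have hCT := (hv.clusterTree_spec (R := R) hρ).2.2
  rw [hT] at hCT
  have hC := cluster_congr hρ hCT hRR
  have hscope : ∀ a ∈ cluster v E M ρ R, timeSupp v a ⊆ treeScope v E M T := fun a ha =>
    timeSupp_subset_treeScope hCT ha (hv.mem_meeting_self (cluster_subset ha))
  refine ⟨fun s hs => (hRR s (hscope ρ (root_mem_cluster hρ) hs)).1 (hρR hs),
    by rw [hC, hT], fun w hw => ?_⟩
  refine (hv.glauberState_congr_cluster (I := I) (I' := I') hE' hρ hρR hCT hRR ?_ M 0 (zero_add M) w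
    ?_).1 (hocc hw)
  · intro u hu
    rcases hbase with hlt | ⟨rfl, hR⟩
    · obtain ⟨a, ha, hua⟩ := mem_biUnion.1 hu
      have h1 := hlt _ (hscope a ha hua)
      have h2 := (hv.nextTime_spec M u).1
      omega
    · rw [glauberState_congr E' v I n M hR]
  · rw [hρ0 w hw]
    exact mem_biUnion.2 ⟨ρ, root_mem_cluster hρ, nextTime_mem_timeSupp hw⟩

open Classical in
/-- The two-trees rooted at `ρ`. -/
noncomputable def twoTrees (v : ℕ → V) (E : Finset (Finset V)) (M : ℕ) (ρ : ℕ × Finset V) :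
    Finset (Finset (ℕ × Finset V)) :=
  {T ∈ (spaceTimeEdges v E M).powerset | IsTwoTree v E M ρ T}

open Classical in
/-- Decomposition of the occupation of `ρ.2` at time `0` according to the two-tree. -/
theorem IsScan.sum_treeIndicator (hv : IsScan v n) (hρ : ρ ∈ spaceTimeEdges v E M)
    (hρ0 : ∀ w ∈ ρ.2, nextTime v 0 w = nextTime v ρ.1 w) :
    ∑ T ∈ twoTrees v E M ρ, treeIndicator E E' v n M ρ T I R =
      if ρ.2 ⊆ glauberState E' v R I 0 (n + M) then 1 else 0 := by
  by_cases hocc : ρ.2 ⊆ glauberState E' v R I 0 (n + M)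
  · have hρR : timeSupp v ρ ⊆ R := by
      intro s hs
      obtain ⟨w, hw, rfl⟩ := mem_image.1 hs
      rw [← hρ0 w hw]
      refine hv.nextTime_mem _ _ _ ?_ (hocc hw)
      have := (hv.nextTime_spec 0 w).2.1
      omega
    obtain ⟨h1, h2, -⟩ := hv.clusterTree_spec (R := R) hρ
    simp only [treeIndicator, hocc, hρR, true_and, and_true, if_true]
    rw [sum_ite_eq, if_pos]
    exact mem_filter.2 ⟨mem_powerset.2 (h2.trans cluster_subset), h1⟩
  · simp [treeIndicator, hocc]

end Locality

/-! ### Bounding the contribution of the two-trees -/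

section Bounds

variable {V : Type*} [DecidableEq V] {E E' : Finset (Finset V)} {v : ℕ → V}
  {n M k Δ : ℕ} {ρ : ℕ × Finset V} {T : Finset (ℕ × Finset V)}

theorem mem_twoTrees : T ∈ twoTrees v E M ρ ↔ T ⊆ spaceTimeEdges v E M ∧ IsTwoTree v E M ρ T := by
  classical
  rw [twoTrees, mem_filter, mem_powerset]

theorem IsScan.sum_twoTrees_le (hv : IsScan v n) (hE : ∀ e ∈ E, #e = k)
    (hΔ : ∀ w, #{e ∈ E | w ∈ e} ≤ Δ) (hρ : ρ ∈ spaceTimeEdges v E M) (hD : 1 ≤ Δ * k ^ 2) {x : ℝ}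
    (hx0 : 0 ≤ x) (hx : x * Real.exp 1 * (Δ * k ^ 2 : ℕ) ^ 2 ≤ 1 / 2) :
    ∑ T ∈ twoTrees v E M ρ, x ^ #T ≤ 1 / 2 := by
  classical
  have hD' : (1 : ℝ) ≤ ((Δ * k ^ 2 : ℕ) : ℝ) ^ 2 := one_le_pow₀ (by exact_mod_cast hD)
  have hxe : x * Real.exp 1 ≤ 1 / 2 :=
    (le_mul_of_one_le_right (by positivity) hD').trans hx
  have hinj : Set.InjOn (fun T : Finset (ℕ × Finset V) => T.erase ρ)
      (twoTrees v E M ρ : Finset (Finset (ℕ × Finset V))) := by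
    intro T hT T' hT' h
    rw [← insert_erase (mem_twoTrees.1 (mem_coe.1 hT)).2.root_mem,
      ← insert_erase (mem_twoTrees.1 (mem_coe.1 hT')).2.root_mem]
    exact congrArg (insert ρ) h
  calc ∑ T ∈ twoTrees v E M ρ, x ^ #T
      = ∑ T ∈ twoTrees v E M ρ, x * x ^ #(T.erase ρ) := by
        refine sum_congr rfl fun T hT => ?_
        rw [← pow_succ', card_erase_add_one (mem_twoTrees.1 hT).2.root_mem]
    _ = x * ∑ B ∈ (twoTrees v E M ρ).image fun T => T.erase ρ, x ^ #B := by
        rw [sum_image hinj, mul_sum]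
    _ ≤ x * ∑ B ∈ (spaceTimeEdges v E M).powerset with
          ReachedFrom (meeting₂ v E M) {ρ} B, x ^ #B := by
        refine mul_le_mul_of_nonneg_left
          (sum_le_sum_of_subset_of_nonneg ?_ fun _ _ _ => by positivity) hx0
        intro B hB
        obtain ⟨T, hT, rfl⟩ := mem_image.1 hB
        have hT := mem_twoTrees.1 hT
        exact mem_filter.2 ⟨mem_powerset.2 ((erase_subset _ _).trans hT.1), hT.2.conn⟩
    _ ≤ x * Real.exp 1 ^ #{ρ} := by
        refine mul_le_mul_of_nonneg_left ?_ hx0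
        refine sum_reachedFrom_le (meeting₂ v E M) ((Δ * k ^ 2) ^ 2) x (Real.exp 1) hx0
          (Real.one_le_exp zero_le_one) ?_ _ _ fun a ha => ?_
        · have h1 : 1 + x * Real.exp 1 ≤ Real.exp (x * Real.exp 1) := by
            rw [add_comm]
            exact Real.add_one_le_exp _
          calc (1 + x * Real.exp 1) ^ ((Δ * k ^ 2) ^ 2)
              ≤ Real.exp (x * Real.exp 1) ^ ((Δ * k ^ 2) ^ 2) := by gcongr
            _ = Real.exp (((Δ * k ^ 2) ^ 2 : ℕ) * (x * Real.exp 1)) := (Real.exp_nat_mul _ _).symm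
            _ ≤ Real.exp 1 := by
                rw [Real.exp_le_exp]
                push_cast at hx ⊢
                linarith
        · have haU : a ∈ spaceTimeEdges v E M := by
            rcases mem_union.1 ha with h | h
            · rwa [mem_singleton.1 h]
            · exact h
          exact hv.card_meeting₂_le hE hΔ (hE _ (mem_spaceTimeEdges.1 haU).2.1).le
    _ ≤ 1 / 2 := by rwa [card_singleton, pow_one]

/-- The total weight of the coin outcomes for which `ρ.2` is occupied and `T` is the two-tree. -/
noncomputable def treeTerm (E E' : Finset (Finset V)) (v : ℕ → V) (n M : ℕ) (ρ : ℕ × Finset V)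
    (p : V → ℂ) (T : Finset (ℕ × Finset V)) (I : Finset V) : ℂ :=
  ∑ R ∈ (Ico 0 (n + M)).powerset, coinWeight (fun s => p (v s)) (Ico 0 (n + M)) R *
    treeIndicator E E' v n M ρ T I R

theorem IsScan.treeScope_subset (hv : IsScan v n) : treeScope v E M T ⊆ Ico 0 (n + M) := by
  intro s hs
  obtain ⟨c, hc, hsc⟩ := mem_biUnion.1 hs
  obtain ⟨b, -, hc⟩ := mem_biUnion.1 hc
  have h1 := (mem_spaceTimeEdges.1 (meeting₂_subset hc)).1
  have h2 := hv.bounds_of_mem_timeSupp hsc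
  rw [mem_Ico]
  omega

theorem IsScan.norm_treeTerm_le_of_local (hv : IsScan v n) (hE : ∀ e ∈ E, #e = k)
    (hΔ : ∀ w, #{e ∈ E | w ∈ e} ≤ Δ) (hρ : ρ ∈ spaceTimeEdges v E M) {p : V → ℂ} {B κ : ℝ}
    (hB1 : 1 ≤ B) (hB : ∀ w, ‖p w‖ + ‖1 - p w‖ ≤ B) (hBK : B ^ ((Δ * k ^ 2) ^ 2 * k) ≤ 2)
    (hκ : ∀ e ∈ E, ∏ w ∈ e, ‖p w‖ ≤ κ) (hT : T ∈ twoTrees v E M ρ) (I : Finset V)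
    {K : Finset ℕ} (hK : K ⊆ Ico 0 (n + M))
    (hloc : ∀ R, treeIndicator E E' v n M ρ T I R =
      treeIndicator E E' v n M ρ T I (R ∩ (treeScope v E M T ∪ K))) :
    ‖treeTerm E E' v n M ρ p T I‖ ≤ (2 * κ) ^ #T * B ^ #K := by
  obtain ⟨hTU, hT⟩ := mem_twoTrees.1 hT
  have hsub : T.biUnion (timeSupp v) ⊆ treeScope v E M T := biUnion_subset.2 fun a ha =>
    timeSupp_subset_treeScope (C := T)
      (fun b hb => mem_biUnion.2 ⟨b, hb, hv.mem_meeting_self (hTU hb)⟩) ha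
      (hv.mem_meeting_self (hTU ha))
  have hprod : ∏ t ∈ T.biUnion (timeSupp v), ‖p (v t)‖ ≤ κ ^ #T := by
    rw [prod_biUnion hT.disj, ← prod_const]
    refine prod_le_prod (fun _ _ => prod_nonneg fun _ _ => norm_nonneg _) fun a ha => ?_
    rw [timeSupp, prod_image fun _ _ _ _ h => hv.nextTime_injective _ h]
    simp only [(hv.nextTime_spec _ _).2.2]
    exact hκ _ (mem_spaceTimeEdges.1 (hTU ha)).2.1
  have hκ0 : 0 ≤ κ :=
    (prod_nonneg fun _ _ => norm_nonneg _).trans (hκ _ (mem_spaceTimeEdges.1 hρ).2.1)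
  have hcard : #(treeScope v E M T ∪ K) ≤ (Δ * k ^ 2) ^ 2 * k * #T + #K :=
    (card_union_le _ _).trans (Nat.add_le_add_right
      ((hv.card_treeScope_le hE hΔ hTU).trans (mul_comm _ _).le) _)
  calc _ ≤ (∏ t ∈ T.biUnion (timeSupp v), ‖p (v t)‖) * B ^ #(treeScope v E M T ∪ K) :=
        norm_sum_coinWeight_le _ (treeScope v E M T ∪ K) _ _
          (union_subset hv.treeScope_subset hK) (hsub.trans subset_union_left) _
          (fun R _ => hloc R) (fun R _ h => hv.treeIndicator_eq_zero hρ h)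
          (fun _ => norm_treeIndicator_le) B hB1 fun _ => hB _
    _ ≤ κ ^ #T * ((B ^ ((Δ * k ^ 2) ^ 2 * k)) ^ #T * B ^ #K) := by
        rw [← pow_mul, ← pow_add]
        gcongr
    _ ≤ κ ^ #T * (2 ^ #T * B ^ #K) := by gcongr
    _ = _ := by rw [mul_pow]; ring

/-- The bound for an arbitrary two-tree. -/
theorem IsScan.norm_treeTerm_le (hv : IsScan v n) (hE : ∀ e ∈ E, #e = k)
    (hΔ : ∀ w, #{e ∈ E | w ∈ e} ≤ Δ) (hE' : E' ⊆ E) (hρ : ρ ∈ spaceTimeEdges v E M)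
    (hρ0 : ∀ w ∈ ρ.2, nextTime v 0 w = nextTime v ρ.1 w) {p : V → ℂ} {B κ : ℝ}
    (hB1 : 1 ≤ B) (hB : ∀ w, ‖p w‖ + ‖1 - p w‖ ≤ B) (hBK : B ^ ((Δ * k ^ 2) ^ 2 * k) ≤ 2)
    (hκ : ∀ e ∈ E, ∏ w ∈ e, ‖p w‖ ≤ κ) (hT : T ∈ twoTrees v E M ρ) (I : Finset V) :
    ‖treeTerm E E' v n M ρ p T I‖ ≤ (2 * κ) ^ #T * B ^ n := by
  have hK : Ico M (n + M) ⊆ Ico 0 (n + M) := Ico_subset_Ico_left (Nat.zero_le _)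
  have := hv.norm_treeTerm_le_of_local (E' := E') hE hΔ hρ hB1 hB hBK hκ hT I hK fun R => ?_
  · rwa [Nat.card_Ico, Nat.add_sub_cancel] at this
  · refine hv.treeIndicator_congr hE' hρ hρ0 (fun s hs => ?_) (Or.inr ⟨rfl, fun s h1 h2 => ?_⟩)
    · simp [hs]
    · have : s ∈ Ico M (n + M) := mem_Ico.2 ⟨h1, by omega⟩
      rw [mem_inter, and_iff_left (mem_union_right _ this)]

/-- A two-tree that does not reach beyond time `M` contributes independently of the initial state,
and without an error from the coins beyond `M`. -/
theorem IsScan.treeTerm_of_scope_lt (hv : IsScan v n) (hE : ∀ e ∈ E, #e = k)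
    (hΔ : ∀ w, #{e ∈ E | w ∈ e} ≤ Δ) (hE' : E' ⊆ E) (hρ : ρ ∈ spaceTimeEdges v E M)
    (hρ0 : ∀ w ∈ ρ.2, nextTime v 0 w = nextTime v ρ.1 w) {p : V → ℂ} {B κ : ℝ}
    (hB1 : 1 ≤ B) (hB : ∀ w, ‖p w‖ + ‖1 - p w‖ ≤ B) (hBK : B ^ ((Δ * k ^ 2) ^ 2 * k) ≤ 2)
    (hκ : ∀ e ∈ E, ∏ w ∈ e, ‖p w‖ ≤ κ) (hT : T ∈ twoTrees v E M ρ)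
    (hlt : ∀ s ∈ treeScope v E M T, s < M) (I : Finset V) :
    treeTerm E E' v n M ρ p T I = treeTerm E E' v n M ρ p T ∅ ∧
      ‖treeTerm E E' v n M ρ p T I‖ ≤ (2 * κ) ^ #T := by
  constructor
  · refine sum_congr rfl fun R _ => ?_
    rw [hv.treeIndicator_congr hE' hρ hρ0 (fun s _ => Iff.rfl) (Or.inl hlt)]
  · have := hv.norm_treeTerm_le_of_local (E' := E') hE hΔ hρ hB1 hB hBK hκ hT I
      (empty_subset _) fun R => ?_
    · rwa [card_empty, pow_zero, mul_one] at this
    · exact hv.treeIndicator_congr hE' hρ hρ0 (fun s hs => by simp [hs]) (Or.inl hlt)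

variable [Fintype V]

open Classical in
/-- Stationarity of the dynamics, combined with the decomposition according to two-trees. -/
theorem IsScan.sum_occupied_eq (hv : IsScan v n) (hρ : ρ ∈ spaceTimeEdges v E M)
    (hρ0 : ∀ w ∈ ρ.2, nextTime v 0 w = nextTime v ρ.1 w) (lam : V → ℂ)
    (hlam : ∀ w, 1 + lam w ≠ 0) :
    ∑ I, gibbsWeight E' lam I * (if ρ.2 ⊆ I then 1 else 0) =
      ∑ T ∈ twoTrees v E M ρ, ∑ I, gibbsWeight E' lam I *
        treeTerm E E' v n M ρ (fun w => lam w / (1 + lam w)) T I := by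
  rw [sum_gibbsWeight_glauberState E' lam hlam v (n + M) 0 fun I => if ρ.2 ⊆ I then 1 else 0,
    sum_comm, zero_add]
  refine sum_congr rfl fun I _ => ?_
  rw [← mul_sum]
  congr 1
  simp only [treeTerm]
  rw [sum_comm]
  refine sum_congr rfl fun R _ => ?_
  rw [← mul_sum, hv.sum_treeIndicator hρ hρ0]

open Classical in
/-- The complex probability that a hyperedge is fully occupied is less than one in modulus. -/
theorem IsScan.norm_sum_occupied_lt (hv : IsScan v n) (hE : ∀ e ∈ E, #e = k)
    (hΔ : ∀ w, #{e ∈ E | w ∈ e} ≤ Δ) (hD : 1 ≤ Δ * k ^ 2) (hE' : E' ⊆ E) (lam : V → ℂ)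
    (hlam : ∀ w, 1 + lam w ≠ 0) {B κ : ℝ} (hB1 : 1 ≤ B)
    (hB : ∀ w, ‖lam w / (1 + lam w)‖ + ‖1 - lam w / (1 + lam w)‖ ≤ B)
    (hBK : B ^ ((Δ * k ^ 2) ^ 2 * k) ≤ 2) (hκ0 : 0 ≤ κ)
    (hκ : ∀ e ∈ E, ∏ w ∈ e, ‖lam w / (1 + lam w)‖ ≤ κ)
    (hκD : 4 * κ * Real.exp 1 * (Δ * k ^ 2 : ℕ) ^ 2 ≤ 1 / 2)
    (hZ : gibbsSum E' lam ≠ 0) (hρE : ρ.2 ∈ E) (hρv : v ρ.1 ∈ ρ.2) (hρn : ρ.1 < n)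
    (hρ0 : ∀ w ∈ ρ.2, nextTime v 0 w = nextTime v ρ.1 w) :
    ‖∑ I, gibbsWeight E' lam I * (if ρ.2 ⊆ I then 1 else 0)‖ < ‖gibbsSum E' lam‖ := by
  set A : ℝ := ∑ I, ‖gibbsWeight E' lam I‖ with hA
  have hA0 : 0 ≤ A := sum_nonneg fun _ _ => norm_nonneg _
  have hZ0 : 0 < ‖gibbsSum E' lam‖ := norm_pos_iff.2 hZ
  -- The contribution of the two-trees reaching beyond `M` is at most `A * B ^ n * 2 ^ (-J)`.
  obtain ⟨J, hJ⟩ : ∃ J : ℕ, A * B ^ n * (1 / 2) ^ J < ‖gibbsSum E' lam‖ := by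
    have : Filter.Tendsto (fun J : ℕ => A * B ^ n * (1 / 2 : ℝ) ^ J) Filter.atTop (nhds 0) := by
      simpa using (tendsto_pow_atTop_nhds_zero_of_lt_one (by norm_num : (0 : ℝ) ≤ 1 / 2)
        (by norm_num)).const_mul (A * B ^ n)
    exact (this.eventually_lt_const hZ0).exists
  set M := 2 * n * J + 3 * n with hM
  have hρ : ρ ∈ spaceTimeEdges v E M := mem_spaceTimeEdges.2 ⟨by omega, hρE, hρv⟩
  have hterm : ∀ T ∈ twoTrees v E M ρ, ‖∑ I, gibbsWeight E' lam I *
      treeTerm E E' v n M ρ (fun w => lam w / (1 + lam w)) T I‖ ≤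
        (4 * κ) ^ #T * (‖gibbsSum E' lam‖ + A * B ^ n * (1 / 2) ^ J) := by
    intro T hT
    have h24 : (2 * κ) ^ #T ≤ (4 * κ) ^ #T := by gcongr; norm_num
    by_cases hlt : ∀ s ∈ treeScope v E M T, s < M
    · have h := hv.treeTerm_of_scope_lt hE hΔ hE' hρ hρ0 hB1 hB hBK hκ hT hlt
      rw [sum_congr rfl fun I _ => congrArg (gibbsWeight E' lam I * ·) (h I).1, ← sum_mul,
        norm_mul, mul_comm]
      refine mul_le_mul ((h ∅).2.trans h24) ?_ (norm_nonneg _) (by positivity)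
      exact le_add_of_nonneg_right (by positivity)
    · push Not at hlt
      obtain ⟨s, hs, hsM⟩ := hlt
      have hJT : J ≤ #T := hv.le_card_of_mem_treeScope (mem_twoTrees.1 hT).2 hρn hs hsM
      calc _ ≤ ∑ I, ‖gibbsWeight E' lam I‖ * ((2 * κ) ^ #T * B ^ n) := by
            refine (norm_sum_le _ _).trans (sum_le_sum fun I _ => ?_)
            rw [norm_mul]
            exact mul_le_mul_of_nonneg_left
              (hv.norm_treeTerm_le hE hΔ hE' hρ hρ0 hB1 hB hBK hκ hT I) (norm_nonneg _)
        _ = (4 * κ) ^ #T * (A * B ^ n * (1 / 2) ^ #T) := by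
            rw [← sum_mul, show 2 * κ = 4 * κ * (1 / 2) by ring, mul_pow]
            ring
        _ ≤ (4 * κ) ^ #T * (A * B ^ n * (1 / 2) ^ J) := by
            have := pow_le_pow_of_le_one (by norm_num : (0 : ℝ) ≤ 1 / 2) (by norm_num) hJT
            gcongr
        _ ≤ _ := by
            gcongr
            exact le_add_of_nonneg_left hZ0.le
  rw [hv.sum_occupied_eq (E := E) hρ hρ0 lam hlam]
  calc _ ≤ ∑ T ∈ twoTrees v E M ρ,
        (4 * κ) ^ #T * (‖gibbsSum E' lam‖ + A * B ^ n * (1 / 2) ^ J) :=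
        (norm_sum_le _ _).trans (sum_le_sum hterm)
    _ ≤ 1 / 2 * (‖gibbsSum E' lam‖ + A * B ^ n * (1 / 2) ^ J) := by
        rw [← sum_mul]
        exact mul_le_mul_of_nonneg_right
          (hv.sum_twoTrees_le hE hΔ hρ hD (by positivity) hκD) (by positivity)
    _ < _ := by linarith

/-- Zero-freeness, adding the hyperedges one at a time. -/
theorem gibbsSum_ne_zero (hE : ∀ e ∈ E, #e = k)
    (hΔ : ∀ w, #{e ∈ E | w ∈ e} ≤ Δ) (hk : 1 ≤ k) (hΔ1 : 1 ≤ Δ) (lam : V → ℂ)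
    (hlam : ∀ w, 1 + lam w ≠ 0) {B κ : ℝ} (hB1 : 1 ≤ B)
    (hB : ∀ w, ‖lam w / (1 + lam w)‖ + ‖1 - lam w / (1 + lam w)‖ ≤ B)
    (hBK : B ^ ((Δ * k ^ 2) ^ 2 * k) ≤ 2) (hκ0 : 0 ≤ κ)
    (hκ : ∀ e ∈ E, ∏ w ∈ e, ‖lam w / (1 + lam w)‖ ≤ κ)
    (hκD : 4 * κ * Real.exp 1 * (Δ * k ^ 2 : ℕ) ^ 2 ≤ 1 / 2) : gibbsSum E lam ≠ 0 := by
  suffices H : ∀ E' ⊆ E, gibbsSum E' lam ≠ 0 from H E subset_rfl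
  intro E'
  induction E' using Finset.induction_on with
  | empty =>
    intro _
    rw [gibbsSum_empty]
    exact prod_ne_zero_iff.2 fun w _ => hlam w
  | insert e E' _ ih =>
    intro hsub
    have heE : e ∈ E := hsub (mem_insert_self _ _)
    have hE' : E' ⊆ E := (subset_insert _ _).trans hsub
    obtain ⟨w₀, hw₀⟩ : e.Nonempty := card_pos.1 (by rw [hE e heE]; omega)
    have : Nonempty V := ⟨w₀⟩
    obtain ⟨v, hv⟩ := exists_isScan (V := V)
    have hex : ∃ t, v t ∈ e := by
      obtain ⟨s, -, -, hs⟩ := hv.hit 0 w₀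
      exact ⟨s, by rwa [hs]⟩
    -- The root is the copy of `e` at the first time at which one of its vertices is scanned.
    have hmin : ∀ w ∈ e, Nat.find hex ≤ nextTime v 0 w := fun w hw =>
      Nat.find_min' hex (by rwa [(hv.nextTime_spec 0 w).2.2])
    have hlt := hv.norm_sum_occupied_lt (ρ := (Nat.find hex, e)) hE hΔ
      (Nat.mul_pos hΔ1 (pow_pos hk 2)) hE' lam hlam hB1 hB hBK hκ0 hκ hκD (ih hE') heE
      (Nat.find_spec hex) ?_ ?_
    · rw [gibbsSum_insert]
      intro h0
      rw [sub_eq_zero.1 h0] at hlt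
      exact lt_irrefl _ hlt
    · have h1 := hmin w₀ hw₀
      have h2 := (hv.nextTime_spec 0 w₀).2.1
      simp only
      omega
    · intro w hw
      obtain ⟨h1, h2, h3⟩ := hv.nextTime_spec 0 w
      exact (hv.nextTime_eq (hmin w hw) (by omega) h3).symm

end Bounds

/-! ### Fugacities in the Lee-Yang region -/

theorem LeeYangCondition.pow_le {k Δ : ℕ} {ε x : ℝ} (h : LeeYangCondition k Δ ε x)
    (hb : 0 ≤ (x + ε) / (1 + x - ε)) :
    ((x + ε) / (1 + x - ε)) ^ k ≤ 1 / (8 * Real.exp 1 ^ 2 * ((Δ * k ^ 2 : ℕ) : ℝ) ^ 2) := by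
  rw [LeeYangCondition] at h
  have h1 : ((x + ε) / (1 + x - ε)) ^ k = (((x + ε) / (1 + x - ε)) ^ ((k : ℝ) / 2)) ^ 2 := by
    rw [← Real.rpow_natCast (_ ^ _), ← Real.rpow_mul hb, ← Real.rpow_natCast]
    congr 1
    push_cast
    ring
  have h2 : (1 / (2 * Real.sqrt 2 * Real.exp 1 * (Δ : ℝ) * (k : ℝ) ^ 2)) ^ 2 =
      1 / (8 * Real.exp 1 ^ 2 * ((Δ * k ^ 2 : ℕ) : ℝ) ^ 2) := by
    rw [div_pow, one_pow]
    congr 1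
    simp only [mul_pow, Real.sq_sqrt (zero_le_two : (0 : ℝ) ≤ 2)]
    push_cast
    ring
  rw [h1, ← h2]
  exact pow_le_pow_left₀ (Real.rpow_nonneg hb _) h.le 2

/-- In the disc of radius `ε` around `x ≥ 0` the heat-bath weights are close to probabilities. -/
theorem heatBath_weights {ε x : ℝ} {z : ℂ} (hε0 : 0 < ε) (hε : ε ≤ 1 / 3) (hx : 0 ≤ x)
    (hz : ‖z - x‖ ≤ ε) :
    1 + z ≠ 0 ∧ ‖z / (1 + z)‖ ≤ (x + ε) / (1 + x - ε) ∧
      ‖z / (1 + z)‖ + ‖1 - z / (1 + z)‖ ≤ 1 + 3 * ε := by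
  have hpos : 0 < 1 + x - ε := by linarith
  have hxn : ‖(x : ℂ)‖ = x := by rw [Complex.norm_real, Real.norm_of_nonneg hx]
  have hnum : ‖z‖ ≤ x + ε := by
    have := norm_add_le (z - x) (x : ℂ)
    rw [sub_add_cancel, hxn] at this
    linarith
  have hden : 1 + x - ε ≤ ‖1 + z‖ := by
    have h1 : ‖(1 + x : ℂ)‖ = 1 + x := by
      rw [show (1 + x : ℂ) = ((1 + x : ℝ) : ℂ) by push_cast; rfl, Complex.norm_real,
        Real.norm_of_nonneg (by linarith)]
    have h2 := norm_sub_le (1 + z) (z - x)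
    rw [show 1 + z - (z - x) = 1 + (x : ℂ) by ring, h1] at h2
    linarith
  have hne : 1 + z ≠ 0 := norm_pos_iff.1 (hpos.trans_le hden)
  refine ⟨hne, ?_, ?_⟩
  · rw [norm_div]
    gcongr
  · have h1 : 1 - z / (1 + z) = 1 / (1 + z) := by
      field_simp
      ring
    rw [h1, norm_div, norm_div, norm_one, ← add_div]
    have hBx : x + ε + 1 ≤ (1 + 3 * ε) * (1 + x - ε) := by nlinarith
    rw [div_le_iff₀ (hpos.trans_le hden)]
    calc ‖z‖ + 1 ≤ x + ε + 1 := by linarith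
      _ ≤ (1 + 3 * ε) * (1 + x - ε) := hBx
      _ ≤ _ := by gcongr

/-! ### Translation to hypergraphs on a vertex set -/

section

variable {α : Type*} (H : Hypergraph α) [Fintype H.vertexSet]

open Classical in
/-- The hyperedges of `H`, as finite sets of vertices. -/
noncomputable def Hypergraph.finsetEdges : Finset (Finset H.vertexSet) :=
  {e | Subtype.val '' (e : Set H.vertexSet) ∈ H.edgeSet}

theorem Hypergraph.mem_finsetEdges {e : Finset H.vertexSet} :
    e ∈ H.finsetEdges ↔ Subtype.val '' (e : Set H.vertexSet) ∈ H.edgeSet := by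
  classical
  simp [Hypergraph.finsetEdges]

theorem Hypergraph.exists_finsetEdge {e : Set α} (he : e ∈ H.edgeSet) :
    ∃ e' ∈ H.finsetEdges, Subtype.val '' (e' : Set H.vertexSet) = e := by
  classical
  have h : Subtype.val '' ((univ.filter fun w : H.vertexSet => (w : α) ∈ e : Finset H.vertexSet) :
      Set H.vertexSet) = e := by
    ext x
    simp only [coe_filter, mem_univ, true_and, Set.mem_image, Set.mem_ofPred_eq]
    constructor
    · rintro ⟨w, hw, rfl⟩
      exact hw
    · intro hx
      exact ⟨⟨x, H.subset_vertexSet_of_mem_edgeSet' he hx⟩, hx, rfl⟩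
  exact ⟨_, H.mem_finsetEdges.2 (by rwa [h]), h⟩

theorem Hypergraph.IsUniform.card_eq {H : Hypergraph α} [Fintype H.vertexSet] {k : ℕ}
    (h : H.IsUniform k) {e : Finset H.vertexSet} (he : e ∈ H.finsetEdges) : #e = k := by
  rw [← h _ (H.mem_finsetEdges.1 he), Set.ncard_image_of_injective _ Subtype.val_injective,
    Set.ncard_coe_finset]

open Classical in
theorem Hypergraph.card_finsetEdges_le_degree (w : H.vertexSet) :
    #{e ∈ H.finsetEdges | w ∈ e} ≤ H.degree w := by
  have hfin : H.edgeSet.Finite :=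
    (Set.toFinite H.vertexSet).finite_subsets.subset
      fun e he => H.subset_vertexSet_of_mem_edgeSet' he
  have hinj : Function.Injective
      fun e : Finset H.vertexSet => Subtype.val '' (e : Set H.vertexSet) := fun e e' h =>
    coe_injective (Set.image_injective.2 Subtype.val_injective h)
  rw [← Set.ncard_coe_finset, ← Set.ncard_image_of_injective _ hinj, Hypergraph.degree]
  refine Set.ncard_le_ncard ?_ (hfin.subset (Set.sep_subset _ _))
  rintro _ ⟨e, he, rfl⟩
  obtain ⟨he, hw⟩ := mem_filter.1 (mem_coe.1 he)
  exact ⟨H.mem_finsetEdges.1 he, ⟨w, hw, rfl⟩⟩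

theorem Hypergraph.indepPoly_eq_gibbsSum (lam : H.vertexSet → ℂ) :
    H.indepPoly lam = gibbsSum H.finsetEdges lam := by
  classical
  rw [Hypergraph.indepPoly, gibbsSum, sum_filter]
  refine Fintype.sum_bijective (fun σ : H.vertexSet → Fin 2 => univ.filter fun w => σ w = 1)
    ⟨?_, ?_⟩ _ _ fun σ => ?_
  · intro σ σ' h
    funext w
    have hw : σ w = 1 ↔ σ' w = 1 := by
      have := congrArg (w ∈ ·) h
      simpa using this
    generalize σ w = a at hw
    generalize σ' w = b at hw
    revert a b
    decide
  · intro I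
    refine ⟨fun w => if w ∈ I then 1 else 0, ?_⟩
    ext w
    by_cases hw : w ∈ I <;> simp [hw]
  · have hiff : H.IsIndepConfig σ ↔
        IsIndepSet H.finsetEdges (univ.filter fun w => σ w = 1) := by
      constructor
      · intro h e he hsub
        obtain ⟨w, ⟨w', hw', hww⟩, hw0⟩ := h _ (H.mem_finsetEdges.1 he)
        obtain rfl := Subtype.ext hww
        have := (mem_filter.1 (hsub hw')).2
        rw [hw0] at this
        exact absurd this (by decide)
      · intro h e he
        obtain ⟨e', he', rfl⟩ := H.exists_finsetEdge he
        obtain ⟨w, hw, hw1⟩ := not_subset.1 (h e' he')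
        refine ⟨w, ⟨w, hw, rfl⟩, ?_⟩
        have hw1' : σ w ≠ 1 := fun h1 => hw1 (mem_filter.2 ⟨mem_univ _, h1⟩)
        generalize σ w = a at hw1'
        revert a
        decide
    simp only [gibbsWeight, hiff]

end

theorem theorem1 (k Δ : ℕ) (hk : 2 ≤ k) (hΔ : 3 ≤ Δ)
    (ε : ℝ) (hε0 : 0 < ε) (hε1 : ε < 1 / (9 * (k : ℝ) ^ 5 * (Δ : ℝ) ^ 2))
    (lamc : ℝ) (hlamc : ∀ x ∈ Set.Ico (0 : ℝ) lamc, LeeYangCondition k Δ ε x)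
    {α : Type*} (H : Hypergraph α) [Fintype H.vertexSet]
    (hunif : H.IsUniform k) (hdeg : ∀ v ∈ H.vertexSet, H.degree v ≤ Δ)
    (lam : H.vertexSet → ℂ) (hlam : ∀ v, lam v ∈ leeYangRegion ε lamc) :
    H.indepPoly lam ≠ 0 := by
  classical
  have hk1 : (1 : ℝ) ≤ k := by exact_mod_cast (by omega : 1 ≤ k)
  have hΔ1 : (1 : ℝ) ≤ Δ := by exact_mod_cast (by omega : 1 ≤ Δ)
  have hD0 : (0 : ℝ) < ((Δ * k ^ 2 : ℕ) : ℝ) := by push_cast; positivity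
  have hεK : ε * (9 * (k : ℝ) ^ 5 * (Δ : ℝ) ^ 2) < 1 := (lt_div_iff₀ (by positivity)).1 hε1
  have hε : ε ≤ 1 / 3 := by
    have h1 : (1 : ℝ) ≤ (k : ℝ) ^ 5 * (Δ : ℝ) ^ 2 :=
      one_le_mul_of_one_le_of_one_le (one_le_pow₀ hk1) (one_le_pow₀ hΔ1)
    nlinarith
  choose x hx hz using hlam
  have hw := fun w => heatBath_weights hε0 hε (hx w).1 (hz w)
  rw [H.indepPoly_eq_gibbsSum]
  refine gibbsSum_ne_zero (B := 1 + 3 * ε)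
    (κ := 1 / (8 * Real.exp 1 ^ 2 * ((Δ * k ^ 2 : ℕ) : ℝ) ^ 2)) (fun e he => hunif.card_eq he)
    (fun w => (H.card_finsetEdges_le_degree w).trans (hdeg w w.2)) (by omega) (by omega) lam
    (fun w => (hw w).1) (by linarith) (fun w => (hw w).2.2) ?_ (by positivity) (fun e he => ?_) ?_
  · calc (1 + 3 * ε) ^ ((Δ * k ^ 2) ^ 2 * k)
        ≤ Real.exp (3 * ε) ^ ((Δ * k ^ 2) ^ 2 * k) := by
          gcongr
          rw [add_comm]
          exact Real.add_one_le_exp _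
      _ = Real.exp (((Δ * k ^ 2) ^ 2 * k : ℕ) * (3 * ε)) := (Real.exp_nat_mul _ _).symm
      _ ≤ Real.exp (Real.log 2) := by
          rw [Real.exp_le_exp]
          have := Real.log_two_gt_d9
          push_cast
          nlinarith
      _ = 2 := Real.exp_log two_pos
  · have hpow : (∏ w ∈ e, ‖lam w / (1 + lam w)‖) ^ k ≤
        (1 / (8 * Real.exp 1 ^ 2 * ((Δ * k ^ 2 : ℕ) : ℝ) ^ 2)) ^ k := by
      rw [← prod_pow]
      nth_rewrite 3 [← hunif.card_eq he]
      rw [← prod_const]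
      refine prod_le_prod (fun _ _ => by positivity) fun w _ => ?_
      refine (pow_le_pow_left₀ (norm_nonneg _) (hw w).2.1 k).trans
        ((hlamc _ (hx w)).pow_le ?_)
      exact (norm_nonneg _).trans (hw w).2.1
    exact (pow_le_pow_iff_left₀ (prod_nonneg fun _ _ => norm_nonneg _) (by positivity)
      (by omega)).1 hpow
  · have he : 1 ≤ Real.exp 1 := Real.one_le_exp zero_le_one
    have : 4 * (1 / (8 * Real.exp 1 ^ 2 * ((Δ * k ^ 2 : ℕ) : ℝ) ^ 2)) * Real.exp 1 *
        ((Δ * k ^ 2 : ℕ) : ℝ) ^ 2 = 1 / 2 * (1 / Real.exp 1) := by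
      field_simp
      norm_num
    rw [this]
    have h1 : 1 / Real.exp 1 ≤ 1 := (div_le_one (Real.exp_pos 1)).2 he
    linarith
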